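/- Theorem. For a measure $\mu$ on $\mathbb R$ write $F[\mu](t)=\int e^{-itx}\,d\mu(x)$, and for $f\in L^1(\mathbb R)$ write $F[f](t)=\int f(x)e^{-itx}\,dx$. For $\tilde c_0,s,L>0$ let $\mathcal A_{\tilde c_0,s}(L)$ be the class of all (continuous versions of) probability densities $f:\mathbb R\to[0,\infty)$ with $$\int_{\mathbb R}|F[f](t)|^2\exp(2\tilde c_0|t|^s)\,dt\le 2\pi L .$$ Let $0<s\le 1$, $\tilde c_0,L,C,C',A>0$, $w'\ge w\ge 0$ and $t_1\ge 0$. There is a constant $c>0$, depending only on $s,\tilde c_0,L,C,C',w,w',t_1,A$, such that the following holds. Let $\varphi$ be a probability measure on $\mathbb R$ with $\varphi([-A,A])\ge \tfrac12$ (every probability measure satisfies this for some $A$) such that $F[\varphi]$ is differentiable at every $t$ with $|t|>t_1$ and, for these $t$, $$|F[\varphi](t)|\le C(1+t^2)^{-w/2},\qquad |F[\varphi]'(t)|\le C'(1+t^2)^{-w'/2}.$$ Then, for every integer $n\ge 3$, $$\inf_{\tilde f_n}\ \sup_{f\in\mathcal A_{\tilde c_0,s}(L)}E\sup_{x\in\mathbb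 R}|\tilde f_n(x)-f(x)|\ \ge\ c\Big(\frac{\log\log n}{n}\Big)^{1/2}(\log n)^{(w+1/2)/s},$$ where the infimum is over all estimators, that is, all measurable maps $\tilde f_n$ of an i.i.d. sample $Y_1,\dots,Y_n$ with law $f*\varphi$ (so $Y_i=X_i+\epsilon_i$ with $X_i$ of density $f$ and an independent error $\epsilon_i$ of law $\varphi$) into the bounded functions on $\mathbb R$. -/

import Mathlib

open MeasureTheory
open scoped ENNReal

noncomputable section

/-- Fourier transform `F[φ](t) = ∫ e^{-itx} dφ(x)` of a measure on the line. -/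
def measureFourier (φ : Measure ℝ) (t : ℝ) : ℂ :=
  ∫ x : ℝ, Complex.exp (-(Complex.I * (t : ℂ) * (x : ℂ))) ∂φ

/-- Fourier transform `F[f](t) = ∫ f(x) e^{-itx} dx` of an integrable function on the line. -/
def densityFourier (f : ℝ → ℝ) (t : ℝ) : ℂ :=
  ∫ x : ℝ, (f x : ℂ) * Complex.exp (-(Complex.I * (t : ℂ) * (x : ℂ)))

/-- The condition on the error law `φ`: for `|t| > t₁` the Fourier transform is differentiable,
and it and its derivative obey
`|F[φ](t)| ≤ C (1+t²)^{-w/2} e^{-c₀|t|^α}` and `|F[φ]'(t)| ≤ C' (1+t²)^{-w'/2} e^{-c₀|t|^α}`. -/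
structure ErrorCondition (φ : Measure ℝ) (C C' w w' t₁ c₀ α : ℝ) : Prop where
  differentiable : ∀ t : ℝ, t₁ < |t| → DifferentiableAt ℝ (measureFourier φ) t
  bound : ∀ t : ℝ, t₁ < |t| →
    ‖measureFourier φ t‖ ≤ C * (1 + t ^ 2) ^ (-w / 2) * Real.exp (-c₀ * |t| ^ α)
  deriv_bound : ∀ t : ℝ, t₁ < |t| →
    ‖deriv (measureFourier φ) t‖ ≤ C' * (1 + t ^ 2) ^ (-w' / 2) * Real.exp (-c₀ * |t| ^ α)

/-- The class `A_{c,s}(L)` of supersmooth probability densities, i.e.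
`∫ |F[f](t)|² exp(2c|t|^s) dt ≤ 2πL`. Such a density agrees almost everywhere with exactly one
continuous function, and this version is the member of the class (the loss below depends on
the values of `f` at all points). -/
def supersmoothClass (c s L : ℝ) : Set (ℝ → ℝ) :=
  {f | Continuous f ∧ (∀ x, 0 ≤ f x) ∧ Integrable f ∧ ∫ x, f x = 1 ∧
    ∫⁻ t : ℝ, ENNReal.ofReal (‖densityFourier f t‖ ^ 2 * Real.exp (2 * c * |t| ^ s))
      ≤ ENNReal.ofReal (2 * Real.pi * L)}

/-- The law of `Y = X + ε`, where `X` has Lebesgue density `f` and the independent error `ε`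
has law `φ`. -/
def observationLaw (f : ℝ → ℝ) (φ : Measure ℝ) : Measure ℝ :=
  Measure.conv (volume.withDensity (fun x => ENNReal.ofReal (f x))) φ

/-- The law of an i.i.d. sample `Y₁, …, Yₙ`. -/
def sampleLaw (f : ℝ → ℝ) (φ : Measure ℝ) (n : ℕ) : Measure (Fin n → ℝ) :=
  Measure.pi (fun _ : Fin n => observationLaw f φ)

/-- An estimator: a measurable map from samples to bounded functions on the line
(measurable for the product σ-algebra, i.e. each value `T y x` is measurable in `y`). -/
structure IsEstimator {n : ℕ} (T : (Fin n → ℝ) → ℝ → ℝ) : Prop where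
  measurable : Measurable T
  bounded : ∀ y, ∃ B : ℝ, ∀ x, |T y x| ≤ B

/-- The sup-norm risk `E sup_x |T(Y₁, …, Yₙ)(x) - f(x)|`, as an extended nonnegative number. -/
def supRisk (φ : Measure ℝ) {n : ℕ} (T : (Fin n → ℝ) → ℝ → ℝ) (f : ℝ → ℝ) : ℝ≥0∞ :=
  ∫⁻ y, ⨆ x : ℝ, ENNReal.ofReal |T y x - f x| ∂(sampleLaw f φ n)

/-- The minimax sup-norm risk over a class `𝓕` of densities from `n` observations:
infimum over all estimators of the maximal risk over `𝓕`. -/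
def minimaxRisk (φ : Measure ℝ) (𝓕 : Set (ℝ → ℝ)) (n : ℕ) : ℝ≥0∞ :=
  ⨅ T : {T : (Fin n → ℝ) → ℝ → ℝ // IsEstimator T}, ⨆ f ∈ 𝓕, supRisk φ T.1 f

end

/-! The risk is bounded below by testing among `M` densities. The base density is a Cauchy density
whose scale is large enough to put it in the class with half of the budget `2πL` to spare. The
hypotheses are `cauchyDensity σ + b G(T(x - z_m))`, where the Fourier transform of `G` lives in an
annulus and the centres `z_m = m y₀ / T` form a grid in `[0, 1]`. Two hypotheses differ by at least
`b G(0) / 2` at a centre, and about `T` of them fit.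

Three constraints are balanced, with `l = log n`. Membership in the class costs about `(b² / T)
exp(2c(4πT)^s)`; taking `T = (a l)^(1/s)` with `a` small turns the exponential into `√n`, which
`b²`, of order `1/n` up to powers of `l` and a factor `log l`, absorbs. Nonnegativity needs `b`
below a constant. Indistinguishability is measured by the second moment of the likelihood ratio, `1
+ ∫ q² / p`, where `p` and `q` are the base density and the perturbation convolved with the error
law.

Since the Cauchy tail gives `p ≥ κ / (1 + y²)`, it is enough to bound `∫ q² (1 + y²)`. By Plancherel
this is controlled by the `L²` norms of the Fourier transform of `q` and of its derivative, and here
the two bounds on the characteristic function of the error enter: the result is of order `b²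
T^(-(2w+1))` (`lintegral_weighted_measureConv_le`). Choosing `b` to make it a constant times `log l
/ n`, the `n`-fold second moment is at most `l^(1/(2s))`, which is below `M / 4` because `M` is of
order `l^(1/s)`. Disjointness of the `M` acceptance events and Cauchy–Schwarz then force an error
probability of at least `1/2` under some hypothesis (`exists_measure_le_half`), and `b` is the
claimed rate up to a constant. -/

/-! ### Reduction of sup-norm estimation to testing many hypotheses -/

/-- Tonelli's theorem for products of functions of the coordinates. -/
theorem lintegral_pi_prod {n : ℕ} (ν : Measure ℝ) [IsProbabilityMeasure ν]
    (g : Fin n → ℝ → ℝ≥0∞) (hg : ∀ i, Measurable (g i)) :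
    ∫⁻ y, ∏ i, g i (y i) ∂(Measure.pi fun _ : Fin n => ν) = ∏ i, ∫⁻ x, g i x ∂ν := by
  have h := ProbabilityTheory.lintegral_prod_eq_prod_lintegral_of_indepFun Finset.univ
    (fun (i : Fin n) (y : Fin n → ℝ) => g i (y i))
    (ProbabilityTheory.iIndepFun_pi (μ := fun _ : Fin n => ν) fun i => (hg i).aemeasurable)
    (fun i => (hg i).comp (measurable_pi_apply i))
  rw [h]
  refine Finset.prod_congr rfl fun i _ => ?_
  exact (measurePreserving_eval (fun _ : Fin n => ν) i).lintegral_comp (hg i)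

/-- A product of measures with densities has the product density. -/
theorem pi_withDensity {n : ℕ} (ν : Measure ℝ) [IsProbabilityMeasure ν] (r : ℝ → ℝ≥0∞)
    (hr : Measurable r) [SigmaFinite (ν.withDensity r)] :
    (Measure.pi fun _ : Fin n => ν.withDensity r)
      = (Measure.pi fun _ : Fin n => ν).withDensity fun y => ∏ i, r (y i) := by
  refine Measure.pi_eq fun s hs => ?_
  rw [withDensity_apply _ (MeasurableSet.univ_pi hs),
    ← lintegral_indicator (MeasurableSet.univ_pi hs)]
  have h : ∀ y : Fin n → ℝ, (Set.univ.pi s).indicator (fun y => ∏ i, r (y i)) y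
      = ∏ i, (s i).indicator r (y i) := by
    intro y
    by_cases hy : y ∈ Set.univ.pi s
    · rw [Set.indicator_of_mem hy]
      exact Finset.prod_congr rfl fun i _ => (Set.indicator_of_mem (hy i trivial) _).symm
    · rw [Set.indicator_of_notMem hy]
      simp only [Set.mem_pi, Set.mem_univ, true_implies, not_forall] at hy
      obtain ⟨i, hi⟩ := hy
      exact (Finset.prod_eq_zero (Finset.mem_univ i) (Set.indicator_of_notMem hi _)).symm
  simp_rw [h]
  rw [lintegral_pi_prod ν _ fun i => hr.indicator (hs i)]
  refine Finset.prod_congr rfl fun i _ => ?_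
  rw [lintegral_indicator (hs i), withDensity_apply _ (hs i)]

/-- Change of measure by the Cauchy–Schwarz inequality. -/
theorem withDensity_apply_le_rpow {Ω : Type*} [MeasurableSpace Ω] (ν : Measure Ω)
    (r : Ω → ℝ≥0∞) (hr : Measurable r) (E : Set Ω) (hE : MeasurableSet E) :
    ν.withDensity r E ≤ (ν E * ∫⁻ y, r y ^ 2 ∂ν) ^ (1 / 2 : ℝ) := by
  rw [withDensity_apply _ hE, ← lintegral_indicator hE]
  have h1 : ∀ y, E.indicator r y = (E.indicator (fun _ => (1 : ℝ≥0∞)) * r) y := by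
    intro y
    by_cases hy : y ∈ E <;> simp [hy]
  simp_rw [h1]
  refine (ENNReal.lintegral_mul_le_Lp_mul_Lq ν Real.HolderConjugate.two_two
    ((measurable_const.indicator hE).aemeasurable) hr.aemeasurable).trans ?_
  rw [ENNReal.mul_rpow_of_nonneg _ _ (by norm_num : (0 : ℝ) ≤ 1 / 2)]
  have h2 : ∫⁻ y, (E.indicator (fun _ => (1 : ℝ≥0∞)) y) ^ (2 : ℝ) ∂ν = ν E := by
    rw [← lintegral_indicator_one hE]
    refine lintegral_congr fun y => ?_
    by_cases hy : y ∈ E <;> simp [hy]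
  rw [h2]
  simp

/-- Lower bound for the probability of error with many hypotheses dominated by a common law. -/
theorem exists_measure_le_half {Ω : Type*} [MeasurableSpace Ω] (ν : Measure Ω)
    [IsProbabilityMeasure ν] {M : ℕ} (hM : 0 < M) (r : Fin M → Ω → ℝ≥0∞)
    (hr : ∀ m, Measurable (r m)) (E : Fin M → Set Ω) (hE : ∀ m, MeasurableSet (E m))
    (hdisj : Pairwise (Function.onFun Disjoint E))
    (hB : ∀ m, ∫⁻ y, r m y ^ 2 ∂ν ≤ (M : ℝ≥0∞) / 4) :
    ∃ m, ν.withDensity (r m) (E m) ≤ 1 / 2 := by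
  have hM0 : (M : ℝ≥0∞) ≠ 0 := by simpa using hM.ne'
  have hMt : (M : ℝ≥0∞) ≠ ⊤ := ENNReal.natCast_ne_top M
  -- Pigeonhole: the disjoint events share total mass at most one under the common law.
  obtain ⟨m, hm⟩ : ∃ m, ν (E m) ≤ (M : ℝ≥0∞)⁻¹ := by
    by_contra! hcon
    have h1 : ∑ m, ν (E m) ≤ 1 := by
      have hU := measure_iUnion (μ := ν) hdisj hE
      rw [tsum_fintype] at hU
      exact hU ▸ prob_le_one
    have : Nonempty (Fin M) := ⟨⟨0, hM⟩⟩
    have h2 : ∑ _m : Fin M, (M : ℝ≥0∞)⁻¹ < ∑ m, ν (E m) :=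
      ENNReal.sum_lt_sum_of_nonempty Finset.univ_nonempty fun m _ => hcon m
    rw [Finset.sum_const, Finset.card_univ, Fintype.card_fin, nsmul_eq_mul,
      ENNReal.mul_inv_cancel hM0 hMt] at h2
    exact absurd h1 (not_le.2 h2)
  -- Cauchy–Schwarz bounds the probability by the square root of `(1/M) (M/4)`. Only the selected
  -- index needs to be small, so no average over hypotheses is taken.
  refine ⟨m, (withDensity_apply_le_rpow ν (r m) (hr m) (E m) (hE m)).trans ?_⟩
  have h3 : ν (E m) * ∫⁻ y, r m y ^ 2 ∂ν ≤ (1 / 2) ^ (2 : ℝ) := by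
    calc ν (E m) * ∫⁻ y, r m y ^ 2 ∂ν ≤ (M : ℝ≥0∞)⁻¹ * ((M : ℝ≥0∞) / 4) := by
          gcongr
          exact hB m
      _ = 4⁻¹ := by
          rw [div_eq_mul_inv, ← mul_assoc, ENNReal.inv_mul_cancel hM0 hMt, one_mul]
      _ = (1 / 2) ^ (2 : ℝ) := by
          rw [ENNReal.rpow_ofNat, one_div, ← ENNReal.inv_pow]
          norm_num
  calc _ ≤ (((1 : ℝ≥0∞) / 2) ^ (2 : ℝ)) ^ (1 / 2 : ℝ) := by gcongr
    _ = 1 / 2 := by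
      rw [← ENNReal.rpow_mul]
      norm_num

/-- Reduction of the minimax sup-norm risk to a testing problem with many hypotheses. -/
theorem le_minimaxRisk (φ : Measure ℝ) (𝓕 : Set (ℝ → ℝ)) (n : ℕ) {M : ℕ} (hM : 0 < M)
    (f : Fin M → ℝ → ℝ) (hf : ∀ m, f m ∈ 𝓕) (x : Fin M → ℝ) {δ : ℝ} (hδ : 0 ≤ δ)
    (hsep : ∀ m l, m ≠ l → δ ≤ |f m (x m) - f l (x m)|)
    (ν : Measure ℝ) [IsProbabilityMeasure ν] (r : Fin M → ℝ → ℝ≥0∞) (hr : ∀ m, Measurable (r m))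
    (hprob : ∀ m, IsProbabilityMeasure (observationLaw (f m) φ))
    (hobs : ∀ m, observationLaw (f m) φ = ν.withDensity (r m)) (b : ℝ≥0∞)
    (hb : ∀ m, ∫⁻ y, r m y ^ 2 ∂ν ≤ b) (hbM : b ^ n ≤ (M : ℝ≥0∞) / 4) :
    ENNReal.ofReal (δ / 4) ≤ minimaxRisk φ 𝓕 n := by
  refine le_iInf fun ⟨T, hT⟩ => ?_
  -- Closeness is required only at the finitely many test points, so that measurability of each
  -- value of the estimator makes the event measurable; the supremum over all points need not be
  -- measurable.
  set E : Fin M → Set (Fin n → ℝ) := fun m => ⋂ j, {y | |T y (x j) - f m (x j)| < δ / 2} with hEdef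
  have hTm : ∀ j, Measurable fun y => T y (x j) := fun j => (measurable_pi_apply _).comp hT.measurable
  have hE : ∀ m, MeasurableSet (E m) := fun m =>
    MeasurableSet.iInter fun j => measurableSet_lt (((hTm j).sub_const _).abs) measurable_const
  have hdisj : Pairwise (Function.onFun Disjoint E) := by
    intro m l hml
    refine Set.disjoint_left.2 fun y hy hy' => ?_
    have h1 : |T y (x m) - f m (x m)| < δ / 2 := Set.mem_iInter.1 hy m
    have h2 : |T y (x m) - f l (x m)| < δ / 2 := Set.mem_iInter.1 hy' m
    have h3 := hsep m l hml
    have h4 := abs_sub (T y (x m) - f l (x m)) (T y (x m) - f m (x m))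
    rw [show T y (x m) - f l (x m) - (T y (x m) - f m (x m)) = f m (x m) - f l (x m) by ring] at h4
    linarith
  have hlaw : ∀ m, sampleLaw (f m) φ n
      = (Measure.pi fun _ : Fin n => ν).withDensity fun y => ∏ i, r m (y i) := by
    intro m
    have := hprob m
    have : SigmaFinite (ν.withDensity (r m)) := by
      rw [← hobs m]
      infer_instance
    rw [sampleLaw, ← pi_withDensity ν (r m) (hr m), hobs m]
  have hrm : ∀ m, Measurable fun y : Fin n → ℝ => ∏ i, r m (y i) := fun m =>
    Finset.measurable_fun_prod _ fun i _ => (hr m).comp (measurable_pi_apply i)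
  obtain ⟨m, hm⟩ := exists_measure_le_half (Measure.pi fun _ : Fin n => ν) hM
    (fun m y => ∏ i, r m (y i)) hrm E hE hdisj (by
      intro m
      simp_rw [← Finset.prod_pow]
      rw [lintegral_pi_prod ν (fun _ x => r m x ^ 2) fun _ => (hr m).pow_const 2]
      rw [Finset.prod_const, Finset.card_univ, Fintype.card_fin]
      exact (pow_le_pow_left' (hb m) n).trans hbM)
  rw [← hlaw m] at hm
  refine le_trans ?_ (le_iSup₂_of_le (f m) (hf m) le_rfl)
  have := hprob m
  have : IsProbabilityMeasure (sampleLaw (f m) φ n) := by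
    unfold sampleLaw
    infer_instance
  have hcompl : (1 : ℝ≥0∞) / 2 ≤ sampleLaw (f m) φ n (E m)ᶜ := by
    rw [prob_compl_eq_one_sub (hE m)]
    calc (1 : ℝ≥0∞) / 2 = 1 - 1 / 2 := by
          rw [one_div, ENNReal.one_sub_inv_two]
      _ ≤ _ := tsub_le_tsub_left hm 1
  calc ENNReal.ofReal (δ / 4) = ENNReal.ofReal (δ / 2) * (1 / 2) := by
        rw [show δ / 4 = δ / 2 * (1 / 2) by ring, ENNReal.ofReal_mul (by linarith)]
        congr 1
        rw [ENNReal.ofReal_div_of_pos (by norm_num)]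
        simp
    _ ≤ ENNReal.ofReal (δ / 2) * sampleLaw (f m) φ n (E m)ᶜ := by gcongr
    _ = ∫⁻ y in (E m)ᶜ, ENNReal.ofReal (δ / 2) ∂(sampleLaw (f m) φ n) := by
        rw [setLIntegral_const]
    _ ≤ ∫⁻ y in (E m)ᶜ, ⨆ x : ℝ, ENNReal.ofReal |T y x - f m x| ∂(sampleLaw (f m) φ n) := by
        refine setLIntegral_mono' (hE m).compl fun y hy => ?_
        simp only [hEdef, Set.mem_compl_iff, Set.mem_iInter, Set.mem_ofPred_eq, not_forall,
          not_lt] at hy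
        obtain ⟨j, hj⟩ := hy
        exact (ENNReal.ofReal_le_ofReal hj).trans
          (le_iSup (fun x => ENNReal.ofReal |T y x - f m x|) (x j))
    _ ≤ _ := setLIntegral_le_lintegral _ _

/-! ### Plancherel and a weighted `L²` bound -/

open scoped FourierTransform in
/-- Plancherel's theorem for the Fourier integral of a function in `L¹ ∩ L²`. -/
theorem eLpNorm_fourier_two {u : ℝ → ℂ} (hu : Integrable u) (hu2 : MemLp u 2) :
    eLpNorm (𝓕 u) 2 = eLpNorm u 2 := by
  set U : Lp ℂ 2 (volume : Measure ℝ) := hu2.toLp u with hU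
  have hcont : Continuous (𝓕 u) :=
    VectorFourier.fourierIntegral_continuous Real.continuous_fourierChar
      (by exact continuous_inner) hu
  -- The Fourier integral and the `L²` extension of the transform are compared by pairing with
  -- smooth compactly supported functions: the extension agrees with the distributional transform,
  -- and the integral is moved onto the test function by self-adjointness.
  have hae : (𝓕 u) =ᵐ[volume] (𝓕 U : Lp ℂ 2 (volume : Measure ℝ)) := by
    refine ae_eq_of_integral_contDiff_smul_eq hcont.locallyIntegrable
      ((Lp.memLp (𝓕 U : Lp ℂ 2 (volume : Measure ℝ))).locallyIntegrable (by norm_num)) ?_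
    intro g hg hgs
    have hgC : ContDiff ℝ (↑(⊤ : ℕ∞)) fun x => (g x : ℂ) := Complex.ofRealCLM.contDiff.comp hg
    have hgCs : HasCompactSupport fun x => (g x : ℂ) :=
      hgs.comp_left (g := fun r : ℝ => (r : ℂ)) Complex.ofReal_zero
    set η : SchwartzMap ℝ ℂ := hgCs.toSchwartzMap hgC with hη
    have hηg : ∀ x, η x = (g x : ℂ) := fun x => rfl
    have h1 : (𝓕 (Lp.toTemperedDistribution U)) η
        = Lp.toTemperedDistribution (𝓕 U : Lp ℂ 2 (volume : Measure ℝ)) η := by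
      rw [Lp.fourier_toTemperedDistribution_eq]
    rw [TemperedDistribution.fourier_apply, Lp.toTemperedDistribution_apply,
      Lp.toTemperedDistribution_apply] at h1
    have h2 : ∫ x, (𝓕 η) x • U x = ∫ x, (𝓕 η) x • u x := by
      refine integral_congr_ae ?_
      filter_upwards [hu2.coeFn_toLp] with x hx
      rw [hU, hx]
    have h3 : ∫ x, (𝓕 η) x • u x = ∫ x, η x • (𝓕 u) x := by
      have := VectorFourier.integral_fourierIntegral_smul_eq_flip (L := innerₗ ℝ)
        Real.continuous_fourierChar (by exact continuous_inner) (η.integrable (μ := volume)) hu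
      simpa [SchwartzMap.fourier_coe] using! this
    rw [h2, h3] at h1
    simpa [hηg] using h1
  rw [eLpNorm_congr_ae hae]
  have h := Lp.norm_fourier_eq U
  rw [Lp.norm_def, Lp.norm_def, ENNReal.toReal_eq_toReal_iff' (Lp.eLpNorm_ne_top _)
    (Lp.eLpNorm_ne_top _)] at h
  rw [h, hU]
  exact eLpNorm_congr_ae hu2.coeFn_toLp

theorem lintegral_enorm_sq_eq_eLpNorm_sq (u : ℝ → ℂ) :
    ∫⁻ x, ‖u x‖ₑ ^ 2 = eLpNorm u 2 ^ 2 := by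
  rw [eLpNorm_eq_lintegral_rpow_enorm_toReal (by norm_num) (by norm_num)]
  rw [← ENNReal.rpow_natCast _ 2, ← ENNReal.rpow_mul]
  simp

open scoped FourierTransform in
/-- The Fourier transform of a differentiable function in a weighted `L²` space. -/
theorem lintegral_weighted_fourier_le {u : ℝ → ℂ} (hu : Integrable u) (hu2 : MemLp u 2)
    (hd : Differentiable ℝ u) (hu' : Integrable (deriv u)) (hu'2 : MemLp (deriv u) 2) :
    ∫⁻ x, ENNReal.ofReal (‖𝓕 u x‖ ^ 2 * (1 + x ^ 2))
      ≤ (∫⁻ x, ‖u x‖ₑ ^ 2) + ∫⁻ x, ‖deriv u x‖ₑ ^ 2 := by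
  have hcont : Continuous (𝓕 u) :=
    VectorFourier.fourierIntegral_continuous Real.continuous_fourierChar
      (by exact continuous_inner) hu
  have h1 : ∀ x, ENNReal.ofReal (‖𝓕 u x‖ ^ 2 * (1 + x ^ 2))
      ≤ ‖𝓕 u x‖ₑ ^ 2 + ‖𝓕 (deriv u) x‖ₑ ^ 2 := by
    intro x
    rw [Real.fourier_deriv hu hd hu']
    rw [← ofReal_norm, ← ofReal_norm, ← ENNReal.ofReal_pow (norm_nonneg _),
      ← ENNReal.ofReal_pow (norm_nonneg _), ← ENNReal.ofReal_add (by positivity) (by positivity)]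
    refine ENNReal.ofReal_le_ofReal ?_
    rw [norm_smul, mul_pow]
    have h2 : ‖(2 * Real.pi * Complex.I * x : ℂ)‖ ^ 2 = (2 * Real.pi) ^ 2 * x ^ 2 := by
      rw [norm_mul, norm_mul, norm_mul, Complex.norm_I, Complex.norm_real, Complex.norm_real,
        Real.norm_eq_abs, Real.norm_eq_abs, mul_one, mul_pow, mul_pow, sq_abs, sq_abs]
      simp [mul_pow]
    rw [h2]
    have h3 : 1 ≤ (2 * Real.pi) ^ 2 := by nlinarith [Real.pi_gt_three]
    nlinarith [mul_nonneg (sq_nonneg x) (sq_nonneg ‖𝓕 u x‖)]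
  calc _ ≤ ∫⁻ x, (‖𝓕 u x‖ₑ ^ 2 + ‖𝓕 (deriv u) x‖ₑ ^ 2) := lintegral_mono h1
    _ = (∫⁻ x, ‖𝓕 u x‖ₑ ^ 2) + ∫⁻ x, ‖𝓕 (deriv u) x‖ₑ ^ 2 :=
        lintegral_add_left (hcont.enorm.measurable.pow_const 2) _
    _ = _ := by
        simp only [lintegral_enorm_sq_eq_eLpNorm_sq, eLpNorm_fourier_two hu hu2,
          eLpNorm_fourier_two hu' hu'2]

/-! ### Convolution with the error law and likelihood ratios -/

/-- The convolution of a function with a measure. -/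
noncomputable def measureConv (f : ℝ → ℝ) (φ : Measure ℝ) (y : ℝ) : ℝ := ∫ x, f (y - x) ∂φ

section Convolution

variable {φ : Measure ℝ} [IsProbabilityMeasure φ]

theorem integrable_shift {f : ℝ → ℝ} (hf : Continuous f) {B : ℝ}
    (hB : ∀ x, |f x| ≤ B) (y : ℝ) : Integrable (fun x => f (y - x)) φ :=
  Integrable.of_bound (by fun_prop) B (Filter.Eventually.of_forall fun x => hB _)

theorem continuous_measureConv {f : ℝ → ℝ} (hf : Continuous f) {B : ℝ} (hB : ∀ x, |f x| ≤ B) :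
    Continuous (measureConv f φ) :=
  continuous_of_dominated (bound := fun _ => B) (fun y => by fun_prop)
    (fun y => Filter.Eventually.of_forall fun x => hB _) (integrable_const B)
    (Filter.Eventually.of_forall fun x => by fun_prop)

theorem measureConv_add {f g : ℝ → ℝ} (hf : Continuous f) (hg : Continuous g) {B B' : ℝ}
    (hB : ∀ x, |f x| ≤ B) (hB' : ∀ x, |g x| ≤ B') (y : ℝ) :
    measureConv (fun x => f x + g x) φ y = measureConv f φ y + measureConv g φ y :=
  integral_add (integrable_shift hf hB y) (integrable_shift hg hB' y)

/-- The law of the observations has the convolution as a Lebesgue density. -/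
theorem observationLaw_eq_withDensity {f : ℝ → ℝ} (hf : Continuous f) {B : ℝ}
    (hB : ∀ x, |f x| ≤ B) (h0 : ∀ x, 0 ≤ f x) :
    observationLaw f φ = volume.withDensity fun y => ENNReal.ofReal (measureConv f φ y) := by
  have hm : Measurable fun x => ENNReal.ofReal (f x) := by fun_prop
  ext s hs
  rw [withDensity_apply _ hs, observationLaw, Measure.conv,
    Measure.map_apply measurable_add hs, Measure.prod_apply_symm (measurable_add hs)]
  have h1 : ∀ x, (volume.withDensity fun x => ENNReal.ofReal (f x))
      ((fun z => (z, x)) ⁻¹' ((fun p : ℝ × ℝ => p.1 + p.2) ⁻¹' s))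
      = ∫⁻ y in s, ENNReal.ofReal (f (y - x)) := by
    intro x
    have hs' : MeasurableSet ((fun z => (z, x)) ⁻¹' ((fun p : ℝ × ℝ => p.1 + p.2) ⁻¹' s)) :=
      (measurable_add hs).preimage (by fun_prop)
    rw [withDensity_apply _ hs', ← lintegral_indicator hs', ← lintegral_indicator hs,
      ← lintegral_add_right_eq_self _ (-x)]
    refine lintegral_congr fun y => ?_
    have hy : y + -x ∈ (fun z => (z, x)) ⁻¹' ((fun p : ℝ × ℝ => p.1 + p.2) ⁻¹' s) ↔ y ∈ s := by
      change y + -x + x ∈ s ↔ y ∈ s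
      rw [neg_add_cancel_right]
    by_cases h : y ∈ s
    · rw [Set.indicator_of_mem (hy.2 h), Set.indicator_of_mem h, sub_eq_add_neg]
    · rw [Set.indicator_of_notMem (mt hy.1 h), Set.indicator_of_notMem h]
  simp_rw [h1]
  rw [lintegral_lintegral_swap (by fun_prop)]
  refine lintegral_congr fun y => ?_
  rw [measureConv, ofReal_integral_eq_lintegral_ofReal (integrable_shift hf hB y)
    (Filter.Eventually.of_forall fun x => h0 _)]

theorem isProbabilityMeasure_observationLaw {f : ℝ → ℝ} (hf : Integrable f)
    (h0 : ∀ x, 0 ≤ f x) (h1 : ∫ x, f x = 1) : IsProbabilityMeasure (observationLaw f φ) := by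
  have : IsProbabilityMeasure (volume.withDensity fun x => ENNReal.ofReal (f x)) := by
    refine ⟨?_⟩
    rw [withDensity_apply _ MeasurableSet.univ, Measure.restrict_univ,
      ← ofReal_integral_eq_lintegral_ofReal hf (Filter.Eventually.of_forall h0), h1]
    simp
  unfold observationLaw
  infer_instance

omit [IsProbabilityMeasure φ] in
theorem measureConv_nonneg {f : ℝ → ℝ} (h0 : ∀ x, 0 ≤ f x) (y : ℝ) : 0 ≤ measureConv f φ y :=
  integral_nonneg fun _ => h0 _

theorem integrable_measureConv {f : ℝ → ℝ} (hf : Continuous f) {B : ℝ}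
    (hB : ∀ x, |f x| ≤ B) (h0 : ∀ x, 0 ≤ f x) (hi : Integrable f) (h1 : ∫ x, f x = 1) :
    Integrable (measureConv f φ) ∧ ∫ y, measureConv f φ y = 1 := by
  have hp := isProbabilityMeasure_observationLaw (φ := φ) hi h0 h1
  have hu := hp.measure_univ
  rw [observationLaw_eq_withDensity hf hB h0, withDensity_apply _ MeasurableSet.univ,
    Measure.restrict_univ] at hu
  have hc := continuous_measureConv (φ := φ) hf hB
  have hint : Integrable (measureConv f φ) := by
    refine ⟨hc.aestronglyMeasurable, ?_⟩
    rw [hasFiniteIntegral_iff_ofReal (Filter.Eventually.of_forall (measureConv_nonneg h0)), hu]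
    exact ENNReal.one_lt_top
  refine ⟨hint, ?_⟩
  rw [integral_eq_lintegral_of_nonneg_ae (Filter.Eventually.of_forall (measureConv_nonneg h0))
    hc.aestronglyMeasurable, hu]
  simp

/-- The law of the observations under `f + g` relative to that under `f`, and the second moment
of the likelihood ratio. -/
theorem exists_likelihoodRatio {f g : ℝ → ℝ} (hf : Continuous f) (hg : Continuous g) {B B' : ℝ}
    (hB : ∀ x, |f x| ≤ B) (hB' : ∀ x, |g x| ≤ B') (hf0 : ∀ x, 0 ≤ f x)
    (hfi : Integrable f) (hf1 : ∫ x, f x = 1)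
    (hfg0 : ∀ x, 0 ≤ f x + g x) (hgi : Integrable g) (hg0 : ∫ x, g x = 0)
    {κ χ : ℝ} (hκ : 0 < κ) (hχ : 0 ≤ χ) (hlow : ∀ y, κ * (1 + y ^ 2)⁻¹ ≤ measureConv f φ y)
    (hchi : ∫⁻ y, ENNReal.ofReal (measureConv g φ y ^ 2 * (1 + y ^ 2)) ≤ ENNReal.ofReal (κ * χ)) :
    ∃ r : ℝ → ℝ≥0∞, Measurable r ∧
      observationLaw (fun x => f x + g x) φ = (observationLaw f φ).withDensity r ∧
      ∫⁻ y, r y ^ 2 ∂(observationLaw f φ) ≤ ENNReal.ofReal (1 + χ) := by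
  have hBB : ∀ x, |f x + g x| ≤ B + B' := fun x =>
    (abs_add_le _ _).trans (add_le_add (hB x) (hB' x))
  have hc := continuous_measureConv (φ := φ) hf hB
  have hcg := continuous_measureConv (φ := φ) hg hB'
  have hfg : Continuous fun x => f x + g x := hf.add hg
  have hfgi : Integrable fun x => f x + g x := hfi.add hgi
  have hpos : ∀ y, 0 < measureConv f φ y := fun y => lt_of_lt_of_le (by positivity) (hlow y)
  have hfg1 : ∫ x, (f x + g x) = 1 := by rw [integral_add hfi hgi, hf1, hg0, add_zero]
  obtain ⟨hi1, hi2⟩ := integrable_measureConv (φ := φ) hf hB hf0 hfi hf1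
  obtain ⟨hj1, hj2⟩ := integrable_measureConv (φ := φ) hfg hBB hfg0 hfgi hfg1
  set p := measureConv f φ with hp
  set q := measureConv g φ with hq
  have hadd : ∀ y, measureConv (fun x => f x + g x) φ y = p y + q y :=
    measureConv_add hf hg hB hB'
  -- Writing `q` as a difference of two probability densities gives both its integrability and its
  -- vanishing integral.
  have hqeq : q = fun y => measureConv (fun x => f x + g x) φ y - p y := by
    ext y
    rw [hadd]
    ring
  have hqi : Integrable q := by
    rw [hqeq]
    exact hj1.sub hi1
  have hq0 : ∫ y, q y = 0 := by
    simp only [hqeq]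
    rw [integral_sub hj1 hi1, hi2, hj2, sub_self]
  have hwm : Continuous fun y => q y ^ 2 * (1 + y ^ 2) := by fun_prop
  have hwi : Integrable fun y => q y ^ 2 * (1 + y ^ 2) := by
    refine ⟨hwm.aestronglyMeasurable, ?_⟩
    rw [hasFiniteIntegral_iff_ofReal (Filter.Eventually.of_forall fun y => by positivity)]
    exact hchi.trans_lt ENNReal.ofReal_lt_top
  have hwle : ∫ y, q y ^ 2 * (1 + y ^ 2) ≤ κ * χ := by
    rw [← ofReal_integral_eq_lintegral_ofReal hwi
      (Filter.Eventually.of_forall fun y => by positivity)] at hchi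
    exact (ENNReal.ofReal_le_ofReal_iff (by positivity)).1 hchi
  have hrm : Measurable fun y => ENNReal.ofReal ((p y + q y) / p y) :=
    ENNReal.measurable_ofReal.comp ((hc.add hcg).measurable.div hc.measurable)
  have hpm : Measurable fun y => ENNReal.ofReal (p y) := by fun_prop
  refine ⟨fun y => ENNReal.ofReal ((p y + q y) / p y), hrm, ?_, ?_⟩
  · rw [observationLaw_eq_withDensity hfg hBB hfg0,
      observationLaw_eq_withDensity hf hB hf0, ← withDensity_mul _ hpm hrm]
    congr 1
    ext y
    simp only [Pi.mul_apply]
    rw [← ENNReal.ofReal_mul (hpos y).le, mul_div_cancel₀ _ (hpos y).ne']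
    exact congrArg _ (hadd y)
  · rw [observationLaw_eq_withDensity hf hB hf0,
      lintegral_withDensity_eq_lintegral_mul _ hpm (hrm.pow_const 2)]
    -- Expanding the square, the linear term `2q` integrates to zero and `p` to one, so only `q² /
    -- p` remains; the lower bound on `p` replaces `1/p` by a polynomial weight.
    have key : ∀ y, p y * ((p y + q y) / p y) ^ 2
        ≤ (p y + 2 * q y) + κ⁻¹ * (q y ^ 2 * (1 + y ^ 2)) := by
      intro y
      have h2 : p y * ((p y + q y) / p y) ^ 2 = p y + 2 * q y + q y ^ 2 * (p y)⁻¹ := by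
        have := (hpos y).ne'
        field_simp
        ring
      have h3 : (p y)⁻¹ ≤ κ⁻¹ * (1 + y ^ 2) := by
        have h4 : (p y)⁻¹ ≤ (κ * (1 + y ^ 2)⁻¹)⁻¹ := inv_anti₀ (by positivity) (hlow y)
        rwa [mul_inv, inv_inv] at h4
      rw [h2]
      nlinarith [mul_le_mul_of_nonneg_left h3 (sq_nonneg (q y))]
    have hlin : Integrable fun y => p y + 2 * q y := hi1.add (hqi.const_mul 2)
    have hall : Integrable fun y => (p y + 2 * q y) + κ⁻¹ * (q y ^ 2 * (1 + y ^ 2)) :=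
      hlin.add (hwi.const_mul κ⁻¹)
    calc _ ≤ ∫⁻ y, ENNReal.ofReal ((p y + 2 * q y) + κ⁻¹ * (q y ^ 2 * (1 + y ^ 2))) := by
          refine lintegral_mono fun y => ?_
          have h0 : 0 ≤ p y + q y := by
            rw [← hadd]
            exact measureConv_nonneg hfg0 y
          simp only [Pi.mul_apply]
          rw [← ENNReal.ofReal_pow (div_nonneg h0 (hpos y).le), ← ENNReal.ofReal_mul (hpos y).le]
          exact ENNReal.ofReal_le_ofReal (key y)
      _ = ENNReal.ofReal (∫ y, (p y + 2 * q y) + κ⁻¹ * (q y ^ 2 * (1 + y ^ 2))) :=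
          (ofReal_integral_eq_lintegral_ofReal hall (Filter.Eventually.of_forall fun y =>
            (mul_nonneg (hpos y).le (sq_nonneg _)).trans (key y))).symm
      _ ≤ _ := ENNReal.ofReal_le_ofReal ?_
    rw [integral_add hlin (hwi.const_mul κ⁻¹),
      integral_add hi1 (hqi.const_mul 2), integral_const_mul, integral_const_mul, hq0, hi2]
    have h6 : κ⁻¹ * ∫ y, q y ^ 2 * (1 + y ^ 2) ≤ κ⁻¹ * (κ * χ) := by gcongr
    rw [inv_mul_cancel_left₀ hκ.ne'] at h6
    linarith

end Convolution

/-! ### The Cauchy base density -/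

/-- The Fourier transform of a density in the normalisation of Mathlib. -/
theorem densityFourier_eq_fourier (f : ℝ → ℝ) (t : ℝ) :
    densityFourier f t = FourierTransform.fourier (fun x => (f x : ℂ)) (t / (2 * Real.pi)) := by
  rw [Real.fourier_real_eq_integral_exp_smul, densityFourier]
  refine integral_congr_ae (Filter.Eventually.of_forall fun x => ?_)
  simp only [smul_eq_mul]
  rw [mul_comm]
  congr 2
  have : (Real.pi : ℂ) ≠ 0 := by exact_mod_cast Real.pi_ne_zero
  push_cast
  field_simp

section Cauchy

/-- The density of the centred Cauchy distribution of scale `σ`. -/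
noncomputable def cauchyDensity (σ x : ℝ) : ℝ := Real.pi⁻¹ * σ * (x ^ 2 + σ ^ 2)⁻¹

variable {σ : ℝ}

theorem cauchyDensity_eq (hσ : 0 < σ) :
    cauchyDensity σ = ProbabilityTheory.cauchyPDFReal 0 ⟨σ, hσ.le⟩ := by
  ext x
  change _ = Real.pi⁻¹ * σ * ((x - 0) ^ 2 + σ ^ 2)⁻¹
  rw [sub_zero, cauchyDensity]

theorem integrable_cauchyDensity (hσ : 0 < σ) : Integrable (cauchyDensity σ) := by
  rw [cauchyDensity_eq hσ]
  exact ProbabilityTheory.integrable_cauchyPDFReal 0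

theorem integral_cauchyDensity (hσ : 0 < σ) : ∫ x, cauchyDensity σ x = 1 := by
  rw [cauchyDensity_eq hσ]
  exact ProbabilityTheory.integral_cauchyPDFReal_eq_one 0 (by
    intro h
    exact hσ.ne' (congrArg NNReal.toReal h))

theorem cauchyDensity_pos (hσ : 0 < σ) (x : ℝ) : 0 < cauchyDensity σ x := by
  have := Real.pi_pos
  unfold cauchyDensity
  positivity

theorem continuous_cauchyDensity (hσ : 0 < σ) : Continuous (cauchyDensity σ) := by
  unfold cauchyDensity
  exact continuous_const.mul (Continuous.inv₀ (by fun_prop) fun x => by positivity)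

theorem cauchyDensity_le (hσ : 0 < σ) (x : ℝ) :
    cauchyDensity σ x ≤ Real.pi⁻¹ * σ * (σ ^ 2)⁻¹ := by
  have := Real.pi_pos
  unfold cauchyDensity
  gcongr
  nlinarith [sq_nonneg x]

/-- Half of the error mass lies in `[-A, A]`, and moving a Cauchy density by at most `A` changes its
quadratic tail only by a constant factor. The constant depends on the error law through `A` alone,
which is what makes the final bound uniform. -/
theorem le_measureConv_cauchyDensity (hσ : 0 < σ) (A : ℝ) (φ : Measure ℝ) [IsProbabilityMeasure φ]
    (hA : 1 / 2 ≤ φ (Set.Icc (-A) A)) (y : ℝ) :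
    σ * (2 * Real.pi * (2 + 2 * A ^ 2 + σ ^ 2))⁻¹ * (1 + y ^ 2)⁻¹
      ≤ measureConv (cauchyDensity σ) φ y := by
  have hpi := Real.pi_pos
  set k := Real.pi⁻¹ * σ * ((2 + 2 * A ^ 2 + σ ^ 2) * (1 + y ^ 2))⁻¹ with hk
  have hk0 : 0 ≤ k := by positivity
  have hint : Integrable (fun x => cauchyDensity σ (y - x)) φ :=
    integrable_shift (continuous_cauchyDensity hσ)
      (fun x => by rw [abs_of_pos (cauchyDensity_pos hσ x)]; exact cauchyDensity_le hσ x) y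
  have hA' : 1 / 2 ≤ φ.real (Set.Icc (-A) A) := by
    have := (ENNReal.toReal_le_toReal (by simp) (measure_ne_top φ _)).2 hA
    simpa [measureReal_def] using this
  calc σ * (2 * Real.pi * (2 + 2 * A ^ 2 + σ ^ 2))⁻¹ * (1 + y ^ 2)⁻¹ = 1 / 2 * k := by
        rw [hk]
        field_simp
    _ ≤ φ.real (Set.Icc (-A) A) * k := by gcongr
    _ = ∫ x in Set.Icc (-A) A, k ∂φ := by
        rw [setIntegral_const, smul_eq_mul]
    _ ≤ ∫ x in Set.Icc (-A) A, cauchyDensity σ (y - x) ∂φ := by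
        refine setIntegral_mono_on (integrable_const _).integrableOn hint.integrableOn
          measurableSet_Icc fun x hx => ?_
        rw [hk, cauchyDensity]
        have hx2 : x ^ 2 ≤ A ^ 2 := by nlinarith [hx.1, hx.2]
        have hpos : 0 < (y - x) ^ 2 + σ ^ 2 := by positivity
        gcongr
        nlinarith [sq_nonneg (y + x), sq_nonneg y, mul_nonneg (sq_nonneg A) (sq_nonneg y),
          mul_nonneg (sq_nonneg σ) (sq_nonneg y)]
    _ ≤ ∫ x, cauchyDensity σ (y - x) ∂φ :=
        setIntegral_le_integral hint
          (Filter.Eventually.of_forall fun x => (cauchyDensity_pos hσ _).le)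

theorem integrableOn_exp_mul_abs_Iic_Ioi {a : ℝ} (ha : 0 < a) (x : ℝ) :
    IntegrableOn (fun v : ℝ => Complex.exp ((a - 2 * Real.pi * x * Complex.I) * v)) (Set.Iic 0) ∧
    IntegrableOn (fun v : ℝ => Complex.exp ((-a - 2 * Real.pi * x * Complex.I) * v))
      (Set.Ioi 0) := by
  constructor
  · refine integrableOn_exp_mul_complex_Iic ?_ 0
    simpa using ha
  · refine integrableOn_exp_mul_complex_Ioi ?_ 0
    simpa using ha

theorem fourier_exp_neg_mul_abs {a : ℝ} (ha : 0 < a) (x : ℝ) :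
    FourierTransform.fourier (fun v : ℝ => (Real.exp (-a * |v|) : ℂ)) x
      = ((2 * a / (a ^ 2 + 4 * Real.pi ^ 2 * x ^ 2) : ℝ) : ℂ) := by
  rw [Real.fourier_real_eq_integral_exp_smul]
  obtain ⟨hi1, hi2⟩ := integrableOn_exp_mul_abs_Iic_Ioi ha x
  have e1 : ∀ v ∈ Set.Iic (0 : ℝ), Complex.exp (↑(-2 * Real.pi * v * x) * Complex.I)
      • (Real.exp (-a * |v|) : ℂ) = Complex.exp ((a - 2 * Real.pi * x * Complex.I) * v) := by
    intro v hv
    rw [abs_of_nonpos hv, smul_eq_mul, Complex.ofReal_exp, ← Complex.exp_add]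
    congr 1
    push_cast
    ring
  have e2 : ∀ v ∈ Set.Ioi (0 : ℝ), Complex.exp (↑(-2 * Real.pi * v * x) * Complex.I)
      • (Real.exp (-a * |v|) : ℂ) = Complex.exp ((-a - 2 * Real.pi * x * Complex.I) * v) := by
    intro v hv
    rw [abs_of_pos hv, smul_eq_mul, Complex.ofReal_exp, ← Complex.exp_add]
    congr 1
    push_cast
    ring
  rw [← intervalIntegral.integral_Iic_add_Ioi (b := 0)
    (hi1.congr_fun (fun v hv => (e1 v hv).symm) measurableSet_Iic)
    (hi2.congr_fun (fun v hv => (e2 v hv).symm) measurableSet_Ioi),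
    setIntegral_congr_fun measurableSet_Iic e1, setIntegral_congr_fun measurableSet_Ioi e2,
    integral_exp_mul_complex_Iic (by simpa using ha), integral_exp_mul_complex_Ioi (by simpa using ha)]
  have hne1 : (a - 2 * Real.pi * x * Complex.I : ℂ) ≠ 0 := fun h => by
    have := congrArg Complex.re h
    simp at this
    exact ha.ne' this
  have hne2 : (-a - 2 * Real.pi * x * Complex.I : ℂ) ≠ 0 := fun h => by
    have := congrArg Complex.re h
    simp at this
    exact ha.ne' this
  have hne3 : ((a : ℂ) ^ 2 + 4 * Real.pi ^ 2 * x ^ 2) ≠ 0 := by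
    have : (0 : ℝ) < a ^ 2 + 4 * Real.pi ^ 2 * x ^ 2 := by positivity
    exact_mod_cast this.ne'
  have hprod : (a - 2 * Real.pi * x * Complex.I : ℂ) * (-a - 2 * Real.pi * x * Complex.I)
      = -((a : ℂ) ^ 2 + 4 * Real.pi ^ 2 * x ^ 2) := by
    linear_combination (4 * Real.pi ^ 2 * x ^ 2 : ℂ) * Complex.I_sq
  push_cast
  simp only [mul_zero, Complex.exp_zero]
  rw [div_add_div _ _ hne1 hne2, hprod, div_eq_div_iff (neg_ne_zero.2 hne3) hne3]
  ring

theorem integrable_exp_neg_mul_abs {a : ℝ} (ha : 0 < a) :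
    Integrable fun v : ℝ => Real.exp (-a * |v|) := by
  have h := (integrableOn_exp_mul_abs_Iic_Ioi ha 0)
  have h1 : IntegrableOn (fun v : ℝ => Real.exp (-a * |v|)) (Set.Iic 0) := by
    refine IntegrableOn.congr_fun (Integrable.norm h.1) (fun v hv => ?_) measurableSet_Iic
    simp [Complex.norm_exp, abs_of_nonpos (show v ≤ 0 from hv)]
  have h2 : IntegrableOn (fun v : ℝ => Real.exp (-a * |v|)) (Set.Ioi 0) := by
    refine IntegrableOn.congr_fun (Integrable.norm h.2) (fun v hv => ?_) measurableSet_Ioi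
    simp [Complex.norm_exp, abs_of_pos (show 0 < v from hv)]
  rw [← integrableOn_univ, ← Set.Iic_union_Ioi (a := (0 : ℝ))]
  exact h1.union h2

theorem integral_exp_neg_mul_abs {a : ℝ} (ha : 0 < a) :
    ∫ v : ℝ, Real.exp (-a * |v|) = 2 / a := by
  have h := fourier_exp_neg_mul_abs ha 0
  rw [Real.fourier_real_eq_integral_exp_smul] at h
  have h2 : ((∫ v : ℝ, Real.exp (-a * |v|) : ℝ) : ℂ) = ((2 / a : ℝ) : ℂ) := by
    have h3 : 2 * a / (a ^ 2 + 4 * Real.pi ^ 2 * 0 ^ 2) = 2 / a := by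
      rw [div_eq_div_iff (by positivity) ha.ne']
      ring
    rw [h3] at h
    rw [← integral_complex_ofReal, ← h]
    simp
  exact_mod_cast h2

/-- The two-sided exponential has an explicit transform, a Cauchy density. Both are integrable and
the exponential is continuous, so Fourier inversion reads the formula backwards. -/
theorem densityFourier_cauchyDensity (hσ : 0 < σ) (t : ℝ) :
    densityFourier (cauchyDensity σ) t = (Real.exp (-σ * |t|) : ℂ) := by
  have hpi := Real.pi_pos
  have ha : 0 < 2 * Real.pi * σ := by positivity
  set e : ℝ → ℂ := fun v => (Real.exp (-(2 * Real.pi * σ) * |v|) : ℂ) with he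
  have hF : FourierTransform.fourier e = fun x => (cauchyDensity σ x : ℂ) := by
    ext x
    rw [he, fourier_exp_neg_mul_abs ha x, cauchyDensity]
    congr 1
    have : x ^ 2 + σ ^ 2 ≠ 0 := by positivity
    have : (2 * Real.pi * σ) ^ 2 + 4 * Real.pi ^ 2 * x ^ 2 ≠ 0 := by positivity
    field_simp
    ring
  have hinv : FourierTransformInv.fourierInv (FourierTransform.fourier e) = e := by
    refine Continuous.fourierInv_fourier_eq (by fun_prop) (integrable_exp_neg_mul_abs ha).ofReal ?_
    rw [hF]
    exact (integrable_cauchyDensity hσ).ofReal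
  rw [densityFourier_eq_fourier, ← hF]
  have h := congrFun hinv (-(t / (2 * Real.pi)))
  rw [Real.fourierInv_eq_fourier_neg, neg_neg] at h
  rw [h]
  simp only [he]
  congr 2
  rw [abs_neg, abs_div, abs_of_pos (show (0 : ℝ) < 2 * Real.pi by positivity)]
  field_simp

end Cauchy

/-! ### A band-limited kernel and its rescalings -/

open scoped FourierTransform in
/-- A smooth even function supported in an annulus of frequencies, and its real, rapidly decaying
inverse Fourier transform. -/
theorem exists_bandlimited_kernel : ∃ (ψ G : ℝ → ℝ) (K : ℝ), 0 < K ∧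
    Differentiable ℝ ψ ∧
    (∀ ξ, |ξ| < 1 → ψ ξ = 0) ∧ (∀ ξ, 2 < |ξ| → ψ ξ = 0) ∧
    (∀ ξ, |ψ ξ| ≤ K) ∧ (∀ ξ, |deriv ψ ξ| ≤ K) ∧
    Continuous G ∧ (∀ x, |G x| ≤ K * (1 + x ^ 2)⁻¹) ∧ 0 < G 0 ∧
    (∀ x, 𝓕 (fun ξ => (ψ ξ : ℂ)) (-x) = (G x : ℂ)) ∧
    (∀ ξ, 𝓕 (fun x => (G x : ℂ)) ξ = (ψ ξ : ℂ)) := by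
  -- Composing a bump around `5/2` of outer radius `1` with `ξ²` gives a function that is
  -- automatically smooth and even, and vanishes unless `3/2 < ξ² < 7/2`, inside the required
  -- annulus.
  let χ : ContDiffBump (5 / 2 : ℝ) := ⟨1 / 2, 1, by norm_num, by norm_num⟩
  set ψ : ℝ → ℝ := fun ξ => χ (ξ ^ 2) with hψ
  have hcd : ContDiff ℝ (↑(⊤ : ℕ∞)) ψ := χ.contDiff.comp (by fun_prop)
  have hz1 : ∀ ξ, |ξ| < 1 → ψ ξ = 0 := by
    intro ξ hξ
    refine χ.zero_of_le_dist ?_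
    have : ξ ^ 2 < 1 := (sq_lt_one_iff_abs_lt_one ξ).2 hξ
    rw [Real.dist_eq, abs_of_neg (by linarith)]
    change (1 : ℝ) ≤ _
    linarith
  have hz2 : ∀ ξ, 2 < |ξ| → ψ ξ = 0 := by
    intro ξ hξ
    refine χ.zero_of_le_dist ?_
    have : 4 < ξ ^ 2 := by
      rw [← sq_abs]
      nlinarith
    rw [Real.dist_eq, abs_of_pos (by linarith)]
    change (1 : ℝ) ≤ _
    linarith
  have hsupp : HasCompactSupport ψ := by
    refine HasCompactSupport.intro (isCompact_Icc (a := (-2 : ℝ)) (b := 2)) fun ξ hξ => hz2 ξ ?_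
    by_contra! h
    exact hξ (abs_le.1 h)
  have hcdC : ContDiff ℝ (↑(⊤ : ℕ∞)) fun ξ => (ψ ξ : ℂ) := Complex.ofRealCLM.contDiff.comp hcd
  have hsuppC : HasCompactSupport fun ξ => (ψ ξ : ℂ) :=
    hsupp.comp_left (g := fun r : ℝ => (r : ℂ)) Complex.ofReal_zero
  set Ψ : SchwartzMap ℝ ℂ := hsuppC.toSchwartzMap hcdC with hΨ
  have hΨψ : (Ψ : ℝ → ℂ) = fun ξ => (ψ ξ : ℂ) := rfl
  have heven : ∀ ξ, ψ (-ξ) = ψ ξ := fun ξ => by simp [hψ]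
  set Γ : SchwartzMap ℝ ℂ := 𝓕 Ψ with hΓ
  have hΓψ : (Γ : ℝ → ℂ) = 𝓕 (fun ξ => (ψ ξ : ℂ)) := by
    rw [hΓ, SchwartzMap.fourier_coe, hΨψ]
  have hΓeven : ∀ x, Γ (-x) = Γ x := by
    intro x
    rw [hΓψ, ← Real.fourierInv_eq_fourier_neg, Real.fourierInv_eq_fourier_comp_neg]
    simp only [heven]
  -- A real symbol gives `conj Γ(x) = Γ(-x)`, and evenness turns this into `conj Γ(x) = Γ(x)`.
  have hreal : ∀ x, ((Γ x).re : ℂ) = Γ x := by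
    intro x
    have h1 : Γ x = _ := (congrFun hΓψ x).trans (Real.fourier_real_eq_integral_exp_smul _ x)
    have h2 : Γ (-x) = _ :=
      (congrFun hΓψ (-x)).trans (Real.fourier_real_eq_integral_exp_smul _ (-x))
    rw [hΓeven] at h2
    rw [← Complex.conj_eq_iff_re]
    nth_rewrite 2 [h2]
    rw [h1, ← integral_conj]
    refine integral_congr_ae (Filter.Eventually.of_forall fun ξ => ?_)
    simp only [smul_eq_mul, map_mul, Complex.conj_ofReal, ← Complex.exp_conj, Complex.conj_I]
    congr 2
    push_cast
    ring
  obtain ⟨K0, hK0⟩ := hsupp.exists_bound_of_continuous hcd.continuous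
  have hdc : Continuous (deriv ψ) := hcd.continuous_deriv (by norm_num)
  obtain ⟨K1, hK1⟩ := hsupp.deriv.exists_bound_of_continuous hdc
  obtain ⟨K2, hK2⟩ := Γ.decay 0 0
  obtain ⟨K3, hK3⟩ := Γ.decay 2 0
  set K := max 1 (max K0 (max K1 (K2 + K3))) with hK
  have hcont : Continuous fun x => (Γ x).re := Complex.continuous_re.comp Γ.continuous
  refine ⟨ψ, fun x => (Γ x).re, K, lt_max_of_lt_left one_pos,
    hcd.differentiable (by norm_num), hz1, hz2, ?_, ?_, hcont, ?_, ?_, ?_, ?_⟩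
  · intro ξ
    exact (hK0 ξ).trans (by simp [hK])
  · intro ξ
    exact (hK1 ξ).trans (by simp [hK])
  · intro x
    have h1 := hK2.2 x
    have h2 := hK3.2 x
    rw [norm_iteratedFDeriv_zero] at h1 h2
    rw [pow_zero, one_mul] at h1
    rw [Real.norm_eq_abs, sq_abs] at h2
    have h3 : |(Γ x).re| ≤ ‖Γ x‖ := Complex.abs_re_le_norm _
    rw [← div_eq_mul_inv, le_div_iff₀ (by positivity)]
    have h4 : K2 + K3 ≤ K := by simp [hK]
    nlinarith [sq_nonneg x, mul_le_mul_of_nonneg_right h3 (sq_nonneg x)]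
  -- The value at the origin is the integral of a nonnegative symbol that equals one at `√(5/2)`.
  · have h0 : Γ 0 = ((∫ ξ, ψ ξ : ℝ) : ℂ) := by
      rw [hΓψ, Real.fourier_real_eq_integral_exp_smul, ← integral_complex_ofReal]
      simp
    simp only [h0, Complex.ofReal_re]
    refine hcd.continuous.integral_pos_of_hasCompactSupport_nonneg_nonzero hsupp
      (fun ξ => χ.nonneg) (x := Real.sqrt (5 / 2)) ?_
    simp only [hψ]
    rw [Real.sq_sqrt (by norm_num)]
    rw [χ.one_of_mem_closedBall (Metric.mem_closedBall_self (by exact χ.rIn_pos.le))]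
    exact one_ne_zero
  · intro x
    rw [hreal, ← hΓψ, hΓeven]
  · intro ξ
    simp only [hreal]
    have h1 : 𝓕 (fun x => Γ x) ξ = (𝓕⁻ Γ : SchwartzMap ℝ ℂ) ξ := by
      rw [SchwartzMap.fourierInv_coe, Real.fourierInv_eq_fourier_comp_neg]
      simp only [hΓeven]
    rw [h1, hΓ, FourierTransform.fourierInv_fourier_eq]
    rfl

/-- A kernel `G` whose Fourier transform `ψ` is supported in the annulus `1 ≤ |ξ| ≤ 2`. -/
structure IsBandlimitedKernel (ψ G : ℝ → ℝ) (K : ℝ) : Prop where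
  pos : 0 < K
  differentiable : Differentiable ℝ ψ
  eq_zero_of_lt : ∀ ξ, |ξ| < 1 → ψ ξ = 0
  eq_zero_of_gt : ∀ ξ, 2 < |ξ| → ψ ξ = 0
  bound : ∀ ξ, |ψ ξ| ≤ K
  deriv_bound : ∀ ξ, |deriv ψ ξ| ≤ K
  continuous : Continuous G
  decay : ∀ x, |G x| ≤ K * (1 + x ^ 2)⁻¹
  pos_zero : 0 < G 0
  fourier_symbol : ∀ x, FourierTransform.fourier (fun ξ => (ψ ξ : ℂ)) (-x) = (G x : ℂ)
  fourier_kernel : ∀ ξ, FourierTransform.fourier (fun x => (G x : ℂ)) ξ = (ψ ξ : ℂ)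

/-- The kernel `G` rescaled to height `b`, width `1 / T` and centre `z`. -/
def scaledKernel (G : ℝ → ℝ) (b T z x : ℝ) : ℝ := b * G (T * (x - z))

namespace IsBandlimitedKernel

variable {ψ G : ℝ → ℝ} {K b T z : ℝ}

theorem abs_apply_le (h : IsBandlimitedKernel ψ G K) (x : ℝ) : |G x| ≤ K := by
  refine (h.decay x).trans ?_
  have h1 : (1 + x ^ 2)⁻¹ ≤ 1 := inv_le_one_of_one_le₀ (by nlinarith [sq_nonneg x])
  nlinarith [h.pos]

theorem integrable (h : IsBandlimitedKernel ψ G K) : Integrable G :=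
  (integrable_inv_one_add_sq.const_mul K).mono' h.continuous.aestronglyMeasurable
    (Filter.Eventually.of_forall h.decay)

theorem continuous_scaledKernel (h : IsBandlimitedKernel ψ G K) :
    Continuous (scaledKernel G b T z) := by
  have := h.continuous
  unfold scaledKernel
  fun_prop

theorem abs_scaledKernel_le (h : IsBandlimitedKernel ψ G K) (hb : 0 ≤ b) (x : ℝ) :
    |scaledKernel G b T z x| ≤ b * K := by
  rw [scaledKernel, abs_mul, abs_of_nonneg hb]
  gcongr
  exact h.abs_apply_le _

theorem integrable_scaledKernel (h : IsBandlimitedKernel ψ G K) (hT : 0 < T) :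
    Integrable (scaledKernel G b T z) :=
  ((h.integrable.comp_mul_left' hT.ne').comp_sub_right z).const_mul b

theorem densityFourier_scaledKernel (h : IsBandlimitedKernel ψ G K) (hT : 0 < T) (t : ℝ) :
    densityFourier (scaledKernel G b T z) t
      = (b / T : ℝ) * Complex.exp (-(Complex.I * t * z)) * ψ (t / (2 * Real.pi * T)) := by
  have hT' : (T : ℂ) ≠ 0 := by exact_mod_cast hT.ne'
  have hpi : (Real.pi : ℂ) ≠ 0 := by exact_mod_cast Real.pi_ne_zero
  rw [← h.fourier_kernel, Real.fourier_real_eq_integral_exp_smul, densityFourier]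
  rw [← integral_add_right_eq_self _ z]
  set F : ℝ → ℂ := fun x => Complex.exp (↑(-2 * Real.pi * x * (t / (2 * Real.pi * T))) * Complex.I)
    • (G x : ℂ) with hF
  have h1 : ∀ x : ℝ, (scaledKernel G b T z (x + z) : ℂ)
      * Complex.exp (-(Complex.I * t * ((x + z : ℝ) : ℂ)))
      = (b * Complex.exp (-(Complex.I * t * z))) * F (T * x) := by
    intro x
    have h2 : Complex.exp (-(Complex.I * t * ((x + z : ℝ) : ℂ)))
        = Complex.exp (-(Complex.I * t * z))
          * Complex.exp (↑(-2 * Real.pi * (T * x) * (t / (2 * Real.pi * T))) * Complex.I) := by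
      rw [← Complex.exp_add]
      congr 1
      push_cast
      field_simp
      ring
    rw [h2, scaledKernel, hF, add_sub_cancel_right]
    simp only [smul_eq_mul]
    push_cast
    ring
  simp_rw [h1]
  rw [integral_const_mul, Measure.integral_comp_mul_left F T, abs_of_pos (inv_pos.2 hT),
    Complex.real_smul]
  push_cast
  field_simp

/-- The symbol vanishes near frequency zero, so adding the kernel does not change the total mass. -/
theorem integral_scaledKernel (h : IsBandlimitedKernel ψ G K) (hT : 0 < T) :
    ∫ x, scaledKernel G b T z x = 0 := by
  have h1 := h.densityFourier_scaledKernel (b := b) (z := z) hT 0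
  rw [zero_div, h.eq_zero_of_lt 0 (by simp), Complex.ofReal_zero, mul_zero] at h1
  have h2 : ((∫ x, scaledKernel G b T z x : ℝ) : ℂ) = 0 := by
    rw [← h1, densityFourier, ← integral_complex_ofReal]
    simp
  exact_mod_cast h2

end IsBandlimitedKernel

/-! ### Weighted `L²` size of the convolved perturbation -/

theorem lintegral_enorm_sq_le_of_bound {v : ℝ → ℂ} {R D : ℝ}
    (hb : ∀ ξ, ‖v ξ‖ ≤ D) (h0 : ∀ ξ, R < |ξ| → v ξ = 0) :
    ∫⁻ ξ, ‖v ξ‖ₑ ^ 2 ≤ ENNReal.ofReal (2 * R * D ^ 2) := by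
  calc ∫⁻ ξ, ‖v ξ‖ₑ ^ 2
      ≤ ∫⁻ ξ, (Set.Icc (-R) R).indicator (fun _ => ENNReal.ofReal (D ^ 2)) ξ := by
        refine lintegral_mono fun ξ => ?_
        by_cases hξ : ξ ∈ Set.Icc (-R) R
        · rw [Set.indicator_of_mem hξ, ← ofReal_norm, ← ENNReal.ofReal_pow (norm_nonneg _)]
          exact ENNReal.ofReal_le_ofReal (pow_le_pow_left₀ (norm_nonneg _) (hb ξ) 2)
        · rw [h0 ξ (by by_contra! h; exact hξ (abs_le.1 h))]
          simp
    _ = ENNReal.ofReal (2 * R * D ^ 2) := by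
        rw [lintegral_indicator measurableSet_Icc, setLIntegral_const, Real.volume_Icc,
          ← ENNReal.ofReal_mul (sq_nonneg D)]
        congr 1
        ring

theorem integrable_of_bound_of_support {v : ℝ → ℂ} {R D : ℝ} (hv : AEStronglyMeasurable v)
    (hb : ∀ ξ, ‖v ξ‖ ≤ D) (h0 : ∀ ξ, R < |ξ| → v ξ = 0) : Integrable v := by
  have h1 : Integrable ((Set.Icc (-R) R).indicator fun _ => D) :=
    (integrable_indicator_iff measurableSet_Icc).2 (integrableOn_const (by simp))
  refine h1.mono' hv (Filter.Eventually.of_forall fun ξ => ?_)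
  by_cases hξ : ξ ∈ Set.Icc (-R) R
  · rw [Set.indicator_of_mem hξ]
    exact hb ξ
  · rw [h0 ξ (by by_contra! h; exact hξ (abs_le.1 h)), Set.indicator_of_notMem hξ, norm_zero]

theorem memLp_two_of_bound_of_support {v : ℝ → ℂ} {R D : ℝ} (hv : AEStronglyMeasurable v)
    (hb : ∀ ξ, ‖v ξ‖ ≤ D) (h0 : ∀ ξ, R < |ξ| → v ξ = 0) : MemLp v 2 := by
  refine ⟨hv, ?_⟩
  have h := (lintegral_enorm_sq_le_of_bound hb h0).trans_lt ENNReal.ofReal_lt_top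
  rw [lintegral_enorm_sq_eq_eLpNorm_sq] at h
  by_contra! hcon
  rw [top_le_iff.1 hcon] at h
  simp at h

/-- The Fourier transform of the convolution of a rescaled kernel with the error law. -/
noncomputable def convolvedSymbol (ψ : ℝ → ℝ) (φ : Measure ℝ) (b T z ξ : ℝ) : ℂ :=
  (b / T : ℝ) * Complex.exp (-(2 * Real.pi * ξ * z) * Complex.I) * ψ (ξ / T)
    * measureFourier φ (2 * Real.pi * ξ)

namespace IsBandlimitedKernel

variable {ψ G : ℝ → ℝ} {K b T z : ℝ}

theorem integrable_symbol (h : IsBandlimitedKernel ψ G K) : Integrable ψ := by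
  refine h.differentiable.continuous.integrable_of_hasCompactSupport
    (HasCompactSupport.intro (isCompact_Icc (a := (-2 : ℝ)) (b := 2)) fun ξ hξ =>
      h.eq_zero_of_gt ξ ?_)
  by_contra! h'
  exact hξ (abs_le.1 h')

theorem scaledKernel_eq_integral (h : IsBandlimitedKernel ψ G K) (hT : 0 < T) (v : ℝ) :
    (scaledKernel G b T z v : ℂ)
      = ∫ ξ : ℝ, (b / T : ℝ) * Complex.exp (2 * Real.pi * ξ * (v - z) * Complex.I)
          * ψ (ξ / T) := by
  have hT' : (T : ℂ) ≠ 0 := by exact_mod_cast hT.ne'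
  set F : ℝ → ℂ := fun η => Complex.exp (↑(-2 * Real.pi * η * (-(T * (v - z)))) * Complex.I)
    • (ψ η : ℂ) with hF
  have h1 : ∀ ξ : ℝ, (b / T : ℝ) * Complex.exp (2 * Real.pi * ξ * (v - z) * Complex.I)
      * ψ (ξ / T) = ((b / T : ℝ) : ℂ) * F (ξ / T) := by
    intro ξ
    simp only [hF, smul_eq_mul]
    rw [mul_assoc]
    congr 3
    push_cast
    field_simp
  simp_rw [h1]
  rw [integral_const_mul, Measure.integral_comp_div F T, abs_of_pos hT, hF,
    ← Real.fourier_real_eq_integral_exp_smul, h.fourier_symbol, scaledKernel, Complex.real_smul]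
  push_cast
  field_simp

/-- Write the kernel by Fourier inversion and exchange the integrals. The error law then enters only
through its characteristic function; the reflection `-y` makes the forward transform an inverse one.
-/
theorem measureConv_scaledKernel (h : IsBandlimitedKernel ψ G K) (hT : 0 < T) (φ : Measure ℝ)
    [IsProbabilityMeasure φ] (y : ℝ) :
    (measureConv (scaledKernel G b T z) φ y : ℂ)
      = FourierTransform.fourier (convolvedSymbol ψ φ b T z) (-y) := by
  have hψ := h.differentiable.continuous
  rw [measureConv, ← integral_complex_ofReal]
  simp_rw [h.scaledKernel_eq_integral hT]
  rw [integral_integral_swap]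
  · rw [Real.fourier_real_eq_integral_exp_smul]
    refine integral_congr_ae (Filter.Eventually.of_forall fun ξ => ?_)
    simp only [smul_eq_mul, convolvedSymbol, measureFourier]
    rw [← integral_const_mul, ← integral_const_mul]
    refine integral_congr_ae (Filter.Eventually.of_forall fun x => ?_)
    simp only
    have h1 : Complex.exp (2 * Real.pi * ξ * ((y - x : ℝ) - z) * Complex.I)
        = Complex.exp (↑(-2 * Real.pi * ξ * -y) * Complex.I)
          * Complex.exp (-(2 * Real.pi * ξ * z) * Complex.I)
          * Complex.exp (-(Complex.I * ((2 * Real.pi * ξ : ℝ) : ℂ) * x)) := by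
      rw [← Complex.exp_add, ← Complex.exp_add]
      congr 1
      push_cast
      ring
    rw [h1]
    ring
  · have h2 : Integrable (fun p : ℝ × ℝ => |b / T| * |ψ (p.2 / T)|) (φ.prod volume) :=
      Integrable.comp_snd (((h.integrable_symbol.comp_div hT.ne').abs).const_mul |b / T|) φ
    refine h2.mono' (Continuous.aestronglyMeasurable ?_) (Filter.Eventually.of_forall fun p => ?_)
    · unfold Function.uncurry
      fun_prop
    · simp only [Function.uncurry]
      rw [norm_mul, norm_mul, Complex.norm_real, Complex.norm_real, Real.norm_eq_abs,
        Real.norm_eq_abs]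
      have h3 : (2 * Real.pi * p.2 * ((y - p.1 : ℝ) - z) * Complex.I : ℂ)
          = ((2 * Real.pi * p.2 * (y - p.1 - z) : ℝ) : ℂ) * Complex.I := by
        push_cast
        ring
      rw [h3, Complex.norm_exp_ofReal_mul_I, mul_one]

end IsBandlimitedKernel

/-- On `|ξ| ≥ T` both polynomial bounds are dominated by `T^(-w)`, the second because `w ≤ w'`. With
exponential rate `0` the factor containing `α` is one. -/
theorem norm_measureFourier_le {φ : Measure ℝ} {C C' w w' t₁ α T ξ : ℝ}
    (hE : ErrorCondition φ C C' w w' t₁ 0 α) (hC : 0 ≤ C) (hC' : 0 ≤ C') (hw : 0 ≤ w)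
    (hww' : w ≤ w') (hT : 1 ≤ T) (ht : t₁ < 2 * Real.pi * T) (hξ : T ≤ |ξ|) :
    DifferentiableAt ℝ (measureFourier φ) (2 * Real.pi * ξ) ∧
      ‖measureFourier φ (2 * Real.pi * ξ)‖ ≤ C * T ^ (-w) ∧
      ‖deriv (measureFourier φ) (2 * Real.pi * ξ)‖ ≤ C' * T ^ (-w) := by
  have hpi := Real.pi_gt_three
  have habs : |2 * Real.pi * ξ| = 2 * Real.pi * |ξ| := by
    rw [abs_mul, abs_of_pos (by positivity)]
  have h1 : t₁ < |2 * Real.pi * ξ| := by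
    rw [habs]
    exact ht.trans_le (by gcongr)
  have h2 : T ≤ |2 * Real.pi * ξ| := by
    rw [habs]
    nlinarith
  have h3 : T ^ 2 ≤ 1 + (2 * Real.pi * ξ) ^ 2 := by
    rw [← sq_abs (2 * Real.pi * ξ)]
    nlinarith
  have h4 : ∀ v, w ≤ v → (1 + (2 * Real.pi * ξ) ^ 2) ^ (-v / 2) ≤ T ^ (-w) := by
    intro v hv
    calc (1 + (2 * Real.pi * ξ) ^ 2) ^ (-v / 2) ≤ (T ^ 2) ^ (-v / 2) :=
          Real.rpow_le_rpow_of_nonpos (by positivity) h3 (by linarith)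
      _ = T ^ (-v) := by
          rw [← Real.rpow_natCast, ← Real.rpow_mul (by linarith)]
          congr 1
          push_cast
          ring
      _ ≤ T ^ (-w) := Real.rpow_le_rpow_of_exponent_le hT (by linarith)
  refine ⟨hE.differentiable _ h1, (hE.bound _ h1).trans ?_, (hE.deriv_bound _ h1).trans ?_⟩
  · rw [neg_zero, zero_mul, Real.exp_zero, mul_one]
    gcongr
    exact h4 w le_rfl
  · rw [neg_zero, zero_mul, Real.exp_zero, mul_one]
    gcongr
    exact h4 w' hww'

namespace IsBandlimitedKernel

variable {ψ G : ℝ → ℝ} {K b T z : ℝ} {φ : Measure ℝ} {C C' w w' t₁ α : ℝ}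

theorem convolvedSymbol_eq_zero_of_lt (h : IsBandlimitedKernel ψ G K) (hT : 0 < T) {ξ : ℝ}
    (hξ : |ξ| < T) : convolvedSymbol ψ φ b T z ξ = 0 := by
  rw [convolvedSymbol, h.eq_zero_of_lt (ξ / T)]
  · simp
  · rwa [abs_div, abs_of_pos hT, div_lt_one hT]

theorem convolvedSymbol_eq_zero_of_gt (h : IsBandlimitedKernel ψ G K) (hT : 0 < T) {ξ : ℝ}
    (hξ : 2 * T < |ξ|) : convolvedSymbol ψ φ b T z ξ = 0 := by
  rw [convolvedSymbol, h.eq_zero_of_gt (ξ / T)]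
  · simp
  · rwa [abs_div, abs_of_pos hT, lt_div_iff₀ hT]

theorem norm_phase (ξ z : ℝ) : ‖Complex.exp (-(2 * Real.pi * ξ * z) * Complex.I)‖ = 1 := by
  have h3 : (-(2 * Real.pi * ξ * z) * Complex.I : ℂ)
      = ((-(2 * Real.pi * ξ * z) : ℝ) : ℂ) * Complex.I := by
    push_cast
    ring
  rw [h3, Complex.norm_exp_ofReal_mul_I]

/-- Size and smoothness of the Fourier transform of the convolved perturbation. -/
theorem convolvedSymbol_bounds (h : IsBandlimitedKernel ψ G K)
    (hE : ErrorCondition φ C C' w w' t₁ 0 α) (hC : 0 ≤ C) (hC' : 0 ≤ C') (hw : 0 ≤ w)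
    (hww' : w ≤ w') (hT : 1 ≤ T) (ht : t₁ < 2 * Real.pi * T) (hb : 0 ≤ b)
    (hz : |z| ≤ 1) (ξ : ℝ) :
    DifferentiableAt ℝ (convolvedSymbol ψ φ b T z) ξ ∧
      ‖convolvedSymbol ψ φ b T z ξ‖
        ≤ b / T * K * (C + 2 * Real.pi * C + 2 * Real.pi * C') * T ^ (-w) ∧
      ‖deriv (convolvedSymbol ψ φ b T z) ξ‖
        ≤ b / T * K * (C + 2 * Real.pi * C + 2 * Real.pi * C') * T ^ (-w) := by
  have hpi := Real.pi_pos
  have hT0 : 0 < T := by linarith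
  have hK := h.pos
  have hbT : 0 ≤ b / T := by positivity
  -- Below `T` the symbol vanishes in a neighbourhood, so nothing is asked of the characteristic
  -- function at low frequencies. From `T` on, `2π|ξ|` exceeds `t₁`.
  rcases lt_or_ge |ξ| T with hξ | hξ
  · have hev : convolvedSymbol ψ φ b T z =ᶠ[nhds ξ] fun _ => 0 := by
      filter_upwards [(continuous_abs.isOpen_preimage _ isOpen_Iio).mem_nhds hξ] with η hη
      exact h.convolvedSymbol_eq_zero_of_lt hT0 hη
    have hnn : 0 ≤ b / T * K * (C + 2 * Real.pi * C + 2 * Real.pi * C') * T ^ (-w) := by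
      positivity
    refine ⟨(differentiableAt_const 0).congr_of_eventuallyEq hev, ?_, ?_⟩
    · rwa [hev.eq_of_nhds, norm_zero]
    · rwa [hev.deriv_eq, deriv_const, norm_zero]
  · obtain ⟨hd, hm, hm'⟩ := norm_measureFourier_le hE hC hC' hw hww' hT ht hξ
    have d1 : HasDerivAt (fun η : ℝ => Complex.exp (-(2 * Real.pi * η * z) * Complex.I))
        (Complex.exp (-(2 * Real.pi * ξ * z) * Complex.I) * (-(2 * Real.pi * z) * Complex.I)) ξ := by
      have hlin : HasDerivAt (fun η : ℝ => (-(2 * Real.pi * η * z) * Complex.I : ℂ))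
          (-(2 * Real.pi * z) * Complex.I) ξ := by
        have h0 : HasDerivAt (fun η : ℝ => (η : ℂ)) 1 ξ := Complex.ofRealCLM.hasDerivAt
        convert! (((h0.const_mul (2 * Real.pi : ℂ)).mul_const (z : ℂ)).neg).mul_const Complex.I
          using 1
        ring
      exact hlin.cexp
    have d2 : HasDerivAt (fun η : ℝ => (ψ (η / T) : ℂ)) ((deriv ψ (ξ / T) / T : ℝ) : ℂ) ξ := by
      have h0 : HasDerivAt (fun η : ℝ => ψ (η / T)) (deriv ψ (ξ / T) * (1 / T)) ξ :=
        (h.differentiable (ξ / T)).hasDerivAt.comp ξ ((hasDerivAt_id ξ).div_const T)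
      rw [mul_one_div] at h0
      exact h0.ofReal_comp
    have d3 : HasDerivAt (fun η : ℝ => measureFourier φ (2 * Real.pi * η))
        ((2 * Real.pi) • deriv (measureFourier φ) (2 * Real.pi * ξ)) ξ := by
      have h0 : HasDerivAt (fun η : ℝ => 2 * Real.pi * η) (2 * Real.pi) ξ := by
        simpa using (hasDerivAt_id ξ).const_mul (2 * Real.pi)
      exact hd.hasDerivAt.scomp ξ h0
    have d4 := ((d1.const_mul ((b / T : ℝ) : ℂ)).mul d2).mul d3
    have d5 : HasDerivAt (convolvedSymbol ψ φ b T z) _ ξ := d4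
    have hw0 : 0 ≤ T ^ (-w) := by positivity
    have hψ := h.bound (ξ / T)
    have hψ' := h.deriv_bound (ξ / T)
    refine ⟨d5.differentiableAt, ?_, ?_⟩
    · rw [convolvedSymbol, norm_mul, norm_mul, norm_mul, norm_phase, Complex.norm_real,
        Complex.norm_real, Real.norm_eq_abs, Real.norm_eq_abs, abs_of_nonneg hbT, mul_one]
      calc b / T * |ψ (ξ / T)| * ‖measureFourier φ (2 * Real.pi * ξ)‖
          ≤ b / T * K * (C * T ^ (-w)) := by gcongr
        _ = b / T * K * C * T ^ (-w) := by ring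
        _ ≤ _ := by
          gcongr
          have h1 : 0 ≤ 2 * Real.pi * C := by positivity
          have h2 : 0 ≤ 2 * Real.pi * C' := by positivity
          linarith
    -- The product rule yields the three terms of the constant: `2πC` from the phase, using `|z| ≤
    -- 1`, `C` from the symbol, using `T ≥ 1`, and `2πC'` from the characteristic function.
    · rw [d5.deriv]
      refine (norm_add_le _ _).trans ?_
      have n1 : ‖((b / T : ℝ) : ℂ) * (Complex.exp (-(2 * Real.pi * ξ * z) * Complex.I)
          * (-(2 * Real.pi * z) * Complex.I))‖ ≤ b / T * (2 * Real.pi) := by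
        rw [norm_mul, norm_mul, norm_phase, Complex.norm_real, Real.norm_eq_abs,
          abs_of_nonneg hbT, one_mul, norm_mul, Complex.norm_I, mul_one, norm_neg]
        have : ‖(2 * Real.pi * z : ℂ)‖ = 2 * Real.pi * |z| := by
          rw [norm_mul, norm_mul, Complex.norm_real, Complex.norm_real, Real.norm_eq_abs,
            Real.norm_eq_abs, abs_of_pos hpi]
          simp
        rw [this]
        exact mul_le_mul_of_nonneg_left (mul_le_of_le_one_right (by positivity) hz) hbT
      have n2 : ‖((b / T : ℝ) : ℂ) * Complex.exp (-(2 * Real.pi * ξ * z) * Complex.I)‖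
          = b / T := by
        rw [norm_mul, norm_phase, Complex.norm_real, Real.norm_eq_abs, abs_of_nonneg hbT, mul_one]
      have n3 : ‖((deriv ψ (ξ / T) / T : ℝ) : ℂ)‖ ≤ K := by
        rw [Complex.norm_real, Real.norm_eq_abs, abs_div, abs_of_pos hT0]
        refine (div_le_self (abs_nonneg _) hT).trans hψ'
      have n4 : ‖(ψ (ξ / T) : ℂ)‖ ≤ K := by
        rw [Complex.norm_real]
        exact hψ
      have n5 : ‖(2 * Real.pi) • deriv (measureFourier φ) (2 * Real.pi * ξ)‖
          ≤ 2 * Real.pi * (C' * T ^ (-w)) := by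
        rw [norm_smul, Real.norm_eq_abs, abs_of_pos (by positivity)]
        gcongr
      have m1 : ‖((b / T : ℝ) : ℂ) * (Complex.exp (-(2 * Real.pi * ξ * z) * Complex.I)
          * (-(2 * Real.pi * z) * Complex.I)) * (ψ (ξ / T) : ℂ)
          + ((b / T : ℝ) : ℂ) * Complex.exp (-(2 * Real.pi * ξ * z) * Complex.I)
            * ((deriv ψ (ξ / T) / T : ℝ) : ℂ)‖ ≤ b / T * (2 * Real.pi) * K + b / T * K := by
        refine (norm_add_le _ _).trans ?_
        rw [norm_mul, norm_mul _ ((deriv ψ (ξ / T) / T : ℝ) : ℂ), n2]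
        gcongr
      calc _ ≤ (b / T * (2 * Real.pi) * K + b / T * K) * (C * T ^ (-w))
            + b / T * K * (2 * Real.pi * (C' * T ^ (-w))) := by
            rw [norm_mul, norm_mul]
            refine add_le_add (mul_le_mul m1 hm (norm_nonneg _) (by positivity)) ?_
            refine mul_le_mul ?_ n5 (norm_nonneg _) (by positivity)
            rw [Pi.mul_apply, norm_mul, n2]
            gcongr
        _ = _ := by ring

/-- The weighted `L²` bound for the convolved perturbation. -/
theorem lintegral_weighted_measureConv_le [IsProbabilityMeasure φ] (h : IsBandlimitedKernel ψ G K)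
    (hE : ErrorCondition φ C C' w w' t₁ 0 α) (hC : 0 ≤ C) (hC' : 0 ≤ C') (hw : 0 ≤ w)
    (hww' : w ≤ w') (hT : 1 ≤ T) (ht : t₁ < 2 * Real.pi * T) (hb : 0 ≤ b) (hz : |z| ≤ 1) :
    ∫⁻ y, ENNReal.ofReal (measureConv (scaledKernel G b T z) φ y ^ 2 * (1 + y ^ 2))
      ≤ ENNReal.ofReal (8 * T
        * (b / T * K * (C + 2 * Real.pi * C + 2 * Real.pi * C') * T ^ (-w)) ^ 2) := by
  have hT0 : 0 < T := by linarith
  have hpi := Real.pi_pos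
  have hK := h.pos
  have hbd := h.convolvedSymbol_bounds hE hC hC' hw hww' hT ht hb hz
  set D := b / T * K * (C + 2 * Real.pi * C + 2 * Real.pi * C') * T ^ (-w) with hDdef
  have hD : 0 ≤ D := by positivity
  set U := convolvedSymbol ψ φ b T z with hU
  have hdiff : Differentiable ℝ U := fun ξ => (hbd ξ).1
  have hz0 : ∀ ξ, 2 * T < |ξ| → U ξ = 0 := fun ξ hξ => h.convolvedSymbol_eq_zero_of_gt hT0 hξ
  have hz1 : ∀ ξ, 2 * T < |ξ| → deriv U ξ = 0 := by
    intro ξ hξ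
    have hev : U =ᶠ[nhds ξ] fun _ => 0 := by
      filter_upwards [(continuous_abs.isOpen_preimage _ isOpen_Ioi).mem_nhds hξ] with η hη
      exact hz0 η hη
    rw [hev.deriv_eq, deriv_const]
  have hm0 : AEStronglyMeasurable U := hdiff.continuous.aestronglyMeasurable
  have hm1 : AEStronglyMeasurable (deriv U) := aestronglyMeasurable_deriv U _
  have key := lintegral_weighted_fourier_le
    (integrable_of_bound_of_support hm0 (fun ξ => (hbd ξ).2.1) hz0)
    (memLp_two_of_bound_of_support hm0 (fun ξ => (hbd ξ).2.1) hz0) hdiff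
    (integrable_of_bound_of_support hm1 (fun ξ => (hbd ξ).2.2) hz1)
    (memLp_two_of_bound_of_support hm1 (fun ξ => (hbd ξ).2.2) hz1)
  have hq : ∀ y, measureConv (scaledKernel G b T z) φ y ^ 2
      = ‖FourierTransform.fourier U (-y)‖ ^ 2 := by
    intro y
    rw [← h.measureConv_scaledKernel hT0, Complex.norm_real, Real.norm_eq_abs, sq_abs]
  calc _ = ∫⁻ y, ENNReal.ofReal (‖FourierTransform.fourier U (-y)‖ ^ 2 * (1 + (-y) ^ 2)) := by
        simp only [hq, neg_sq]
    _ = ∫⁻ y, ENNReal.ofReal (‖FourierTransform.fourier U y‖ ^ 2 * (1 + y ^ 2)) :=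
        lintegral_neg_eq_self
          (fun y => ENNReal.ofReal (‖FourierTransform.fourier U y‖ ^ 2 * (1 + y ^ 2)))
    _ ≤ _ := key
    _ ≤ ENNReal.ofReal (2 * (2 * T) * D ^ 2) + ENNReal.ofReal (2 * (2 * T) * D ^ 2) :=
        add_le_add (lintegral_enorm_sq_le_of_bound (fun ξ => (hbd ξ).2.1) hz0)
          (lintegral_enorm_sq_le_of_bound (fun ξ => (hbd ξ).2.2) hz1)
    _ = _ := by
        rw [← ENNReal.ofReal_add (by positivity) (by positivity)]
        congr 1
        ring

end IsBandlimitedKernel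

/-! ### The perturbed densities belong to the class -/

theorem densityFourier_add {f g : ℝ → ℝ} (hf : Integrable f) (hg : Integrable g) (t : ℝ) :
    densityFourier (fun x => f x + g x) t = densityFourier f t + densityFourier g t := by
  have hphase : ∀ u : ℝ → ℝ, Integrable u → Integrable fun x : ℝ =>
      (u x : ℂ) * Complex.exp (-(Complex.I * (t : ℂ) * (x : ℂ))) := by
    intro u hu
    refine hu.ofReal.mul_bdd (c := 1) (by fun_prop) (Filter.Eventually.of_forall fun x => ?_)
    have : (-(Complex.I * (t : ℂ) * (x : ℂ))) = ((-(t * x) : ℝ) : ℂ) * Complex.I := by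
      push_cast
      ring
    rw [this, Complex.norm_exp_ofReal_mul_I]
  rw [densityFourier, densityFourier, densityFourier, ← integral_add (hphase f hf) (hphase g hg)]
  refine integral_congr_ae (Filter.Eventually.of_forall fun x => ?_)
  simp only
  push_cast
  ring

theorem abs_rpow_le_one_add_abs {s : ℝ} (hs : 0 < s) (hs1 : s ≤ 1) (t : ℝ) :
    |t| ^ s ≤ 1 + |t| := by
  rcases le_total |t| 1 with h | h
  · have := Real.rpow_le_one (abs_nonneg t) h hs.le
    linarith [abs_nonneg t]
  · have := Real.rpow_le_rpow_of_exponent_le h hs1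
    rw [Real.rpow_one] at this
    linarith

/-- For `s ≤ 1` the weight grows at most like `exp(2c(1 + |t|))`, which the Cauchy transform beats
as soon as `σ > c`. The bound tends to zero as `σ` grows. -/
theorem lintegral_cauchy_weight_le {s c σ : ℝ} (hs : 0 < s) (hs1 : s ≤ 1) (hc : 0 < c)
    (hσ : c < σ) :
    ∫⁻ t : ℝ, ENNReal.ofReal (2 * (Real.exp (-σ * |t|) ^ 2 * Real.exp (2 * c * |t| ^ s)))
      ≤ ENNReal.ofReal (2 * Real.exp (2 * c) / (σ - c)) := by
  have ha : 0 < 2 * (σ - c) := by linarith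
  calc _ ≤ ∫⁻ t : ℝ, ENNReal.ofReal (2 * Real.exp (2 * c) * Real.exp (-(2 * (σ - c)) * |t|)) := by
        refine lintegral_mono fun t => ENNReal.ofReal_le_ofReal ?_
        rw [← Real.exp_nat_mul, ← Real.exp_add, mul_assoc 2 (Real.exp (2 * c)), ← Real.exp_add]
        refine mul_le_mul_of_nonneg_left (Real.exp_le_exp.2 ?_) (by norm_num)
        push_cast
        nlinarith [mul_le_mul_of_nonneg_left (abs_rpow_le_one_add_abs hs hs1 t) hc.le]
    _ = ENNReal.ofReal (∫ t : ℝ, 2 * Real.exp (2 * c) * Real.exp (-(2 * (σ - c)) * |t|)) :=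
        (ofReal_integral_eq_lintegral_ofReal ((integrable_exp_neg_mul_abs ha).const_mul _)
          (Filter.Eventually.of_forall fun t => by positivity)).symm
    _ = _ := by
        rw [integral_const_mul, integral_exp_neg_mul_abs ha]
        congr 1
        have : σ - c ≠ 0 := by linarith
        field_simp

section Hypotheses

variable {ψ G : ℝ → ℝ} {K b T z σ : ℝ}

/-- The perturbed Cauchy density. -/
noncomputable def perturbedDensity (σ : ℝ) (G : ℝ → ℝ) (b T z x : ℝ) : ℝ :=
  cauchyDensity σ x + scaledKernel G b T z x

theorem IsBandlimitedKernel.norm_densityFourier_scaledKernel_le (h : IsBandlimitedKernel ψ G K)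
    (hT : 0 < T) (hb : 0 ≤ b) (t : ℝ) :
    ‖densityFourier (scaledKernel G b T z) t‖ ≤ b / T * K ∧
      (4 * Real.pi * T < |t| → densityFourier (scaledKernel G b T z) t = 0) := by
  have hpi := Real.pi_pos
  rw [h.densityFourier_scaledKernel hT]
  constructor
  · have h3 : (-(Complex.I * t * z) : ℂ) = ((-(t * z) : ℝ) : ℂ) * Complex.I := by
      push_cast
      ring
    rw [norm_mul, norm_mul, h3, Complex.norm_exp_ofReal_mul_I, Complex.norm_real,
      Complex.norm_real, Real.norm_eq_abs, Real.norm_eq_abs, mul_one,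
      abs_of_nonneg (by positivity : 0 ≤ b / T)]
    gcongr
    exact h.bound _
  · intro ht
    rw [h.eq_zero_of_gt]
    · simp
    · rw [abs_div, abs_of_pos (by positivity : 0 < 2 * Real.pi * T), lt_div_iff₀ (by positivity)]
      linarith

/-- The kernel decays at least as fast as the Cauchy density; the condition `hP` pays for the
constants, the factor `2 + σ²` accounting for the shift by `z`. -/
theorem IsBandlimitedKernel.perturbedDensity_nonneg (h : IsBandlimitedKernel ψ G K) (hσ : 0 < σ)
    (hT : 1 ≤ T) (hb : 0 ≤ b) (hz : |z| ≤ 1) (hP : b * K * (2 + σ ^ 2) ≤ Real.pi⁻¹ * σ) (x : ℝ) :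
    0 ≤ perturbedDensity σ G b T z x := by
  have hpi := Real.pi_pos
  have hK := h.pos
  have h1 : |scaledKernel G b T z x| ≤ b * K * (1 + (x - z) ^ 2)⁻¹ := by
    rw [scaledKernel, abs_mul, abs_of_nonneg hb, mul_assoc]
    refine mul_le_mul_of_nonneg_left ((h.decay _).trans ?_) hb
    refine mul_le_mul_of_nonneg_left (inv_anti₀ (by positivity) ?_) hK.le
    rw [mul_pow]
    nlinarith [sq_nonneg (x - z), sq_nonneg (T - 1), mul_nonneg (sq_nonneg (x - z))
      (by nlinarith : 0 ≤ T ^ 2 - 1)]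
  have h2 : b * K * (1 + (x - z) ^ 2)⁻¹ ≤ cauchyDensity σ x := by
    rw [cauchyDensity, ← div_eq_mul_inv, ← div_eq_mul_inv,
      div_le_div_iff₀ (by positivity) (by positivity)]
    have hz2 : z ^ 2 ≤ 1 := by
      rw [← sq_abs]
      nlinarith [abs_nonneg z]
    have h3 : x ^ 2 + σ ^ 2 ≤ (2 + σ ^ 2) * (1 + (x - z) ^ 2) := by
      nlinarith [sq_nonneg (x - 2 * z), mul_nonneg (sq_nonneg σ) (sq_nonneg (x - z))]
    calc b * K * (x ^ 2 + σ ^ 2) ≤ b * K * ((2 + σ ^ 2) * (1 + (x - z) ^ 2)) := by gcongr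
      _ = b * K * (2 + σ ^ 2) * (1 + (x - z) ^ 2) := by ring
      _ ≤ _ := by gcongr
  have h4 := neg_abs_le (scaledKernel G b T z x)
  rw [perturbedDensity]
  linarith

theorem IsBandlimitedKernel.perturbedDensity_mem (h : IsBandlimitedKernel ψ G K) {s c L : ℝ}
    (hs : 0 < s) (hs1 : s ≤ 1) (hc : 0 < c) (hL : 0 < L) (hσ : c < σ)
    (hσL : 2 * Real.exp (2 * c) / (σ - c) ≤ Real.pi * L)
    (hT : 1 ≤ T) (hb : 0 ≤ b) (hz : |z| ≤ 1) (hP : b * K * (2 + σ ^ 2) ≤ Real.pi⁻¹ * σ)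
    (hS : 16 * (b ^ 2 / T) * K ^ 2 * Real.exp (2 * c * (4 * Real.pi * T) ^ s) ≤ L) :
    perturbedDensity σ G b T z ∈ supersmoothClass c s L := by
  have hσ0 : 0 < σ := hc.trans hσ
  have hT0 : 0 < T := by linarith
  have hpi := Real.pi_pos
  have hK := h.pos
  refine ⟨(continuous_cauchyDensity hσ0).add h.continuous_scaledKernel,
    h.perturbedDensity_nonneg hσ0 hT hb hz hP,
    (integrable_cauchyDensity hσ0).add (h.integrable_scaledKernel hT0), ?_, ?_⟩
  · simp only [perturbedDensity]
    rw [integral_add (integrable_cauchyDensity hσ0) (h.integrable_scaledKernel hT0),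
      integral_cauchyDensity hσ0, h.integral_scaledKernel hT0, add_zero]
  -- By `|u + v|² ≤ 2|u|² + 2|v|²` the budget splits into `πL` for the Cauchy part and `πL` for the
  -- perturbation, whose transform is supported in an interval of length `8πT`.
  · set W : ℝ := 2 * ((b / T * K) ^ 2 * Real.exp (2 * c * (4 * Real.pi * T) ^ s)) with hW
    have hsplit : ∀ t : ℝ, ENNReal.ofReal (‖densityFourier (perturbedDensity σ G b T z) t‖ ^ 2
        * Real.exp (2 * c * |t| ^ s))
        ≤ ENNReal.ofReal (2 * (Real.exp (-σ * |t|) ^ 2 * Real.exp (2 * c * |t| ^ s)))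
          + (Set.Icc (-(4 * Real.pi * T)) (4 * Real.pi * T)).indicator
            (fun _ => ENNReal.ofReal W) t := by
      intro t
      have h1 : densityFourier (perturbedDensity σ G b T z) t = _ :=
        densityFourier_add (integrable_cauchyDensity hσ0) (h.integrable_scaledKernel hT0) t
      obtain ⟨h2, h3⟩ := h.norm_densityFourier_scaledKernel_le (z := z) hT0 hb t
      have h4 : ‖densityFourier (cauchyDensity σ) t‖ = Real.exp (-σ * |t|) := by
        rw [densityFourier_cauchyDensity hσ0, Complex.norm_real, Real.norm_eq_abs, Real.abs_exp]
      by_cases ht : t ∈ Set.Icc (-(4 * Real.pi * T)) (4 * Real.pi * T)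
      · rw [Set.indicator_of_mem ht, ← ENNReal.ofReal_add (by positivity) (by positivity)]
        refine ENNReal.ofReal_le_ofReal ?_
        have h5 : ‖densityFourier (perturbedDensity σ G b T z) t‖ ^ 2
            ≤ 2 * Real.exp (-σ * |t|) ^ 2 + 2 * (b / T * K) ^ 2 := by
          have h6 : ‖densityFourier (perturbedDensity σ G b T z) t‖
              ≤ Real.exp (-σ * |t|) + b / T * K := by
            rw [h1]
            refine (norm_add_le _ _).trans ?_
            rw [h4]
            gcongr
          calc _ ≤ (Real.exp (-σ * |t|) + b / T * K) ^ 2 := by gcongr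
            _ ≤ _ := by nlinarith [sq_nonneg (Real.exp (-σ * |t|) - b / T * K)]
        have h7 : Real.exp (2 * c * |t| ^ s) ≤ Real.exp (2 * c * (4 * Real.pi * T) ^ s) := by
          gcongr
          exact abs_le.2 ht
        calc _ ≤ (2 * Real.exp (-σ * |t|) ^ 2 + 2 * (b / T * K) ^ 2)
              * Real.exp (2 * c * |t| ^ s) := by gcongr
          _ = 2 * (Real.exp (-σ * |t|) ^ 2 * Real.exp (2 * c * |t| ^ s))
              + 2 * ((b / T * K) ^ 2 * Real.exp (2 * c * |t| ^ s)) := by ring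
          _ ≤ _ := by
            rw [hW]
            gcongr
      · rw [Set.indicator_of_notMem ht, add_zero]
        refine ENNReal.ofReal_le_ofReal ?_
        rw [h1, h3 (by by_contra! h'; exact ht (abs_le.1 h')), add_zero, h4]
        have : 0 ≤ Real.exp (-σ * |t|) ^ 2 * Real.exp (2 * c * |t| ^ s) := by positivity
        linarith
    have hm : Measurable ((Set.Icc (-(4 * Real.pi * T)) (4 * Real.pi * T)).indicator
        fun _ : ℝ => ENNReal.ofReal W) := measurable_const.indicator measurableSet_Icc
    calc _ ≤ _ := lintegral_mono hsplit
      _ = _ := lintegral_add_right _ hm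
      _ ≤ ENNReal.ofReal (Real.pi * L) + ENNReal.ofReal (Real.pi * L) := by
          refine add_le_add ((lintegral_cauchy_weight_le hs hs1 hc hσ).trans
            (ENNReal.ofReal_le_ofReal hσL)) ?_
          rw [lintegral_indicator measurableSet_Icc, setLIntegral_const, Real.volume_Icc,
            ← ENNReal.ofReal_mul (by positivity)]
          refine ENNReal.ofReal_le_ofReal ?_
          calc W * (4 * Real.pi * T - -(4 * Real.pi * T))
              = Real.pi * (16 * (b ^ 2 / T) * K ^ 2
                * Real.exp (2 * c * (4 * Real.pi * T) ^ s)) := by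
                rw [hW]
                field_simp
                ring
            _ ≤ _ := by gcongr
      _ = _ := by
          rw [← ENNReal.ofReal_add (by positivity) (by positivity)]
          congr 1
          ring

/-! ### The lower bound for given parameters -/

/-- A lower bound for the minimax risk under explicit conditions on the size `b`, the bandwidth `T`
and the number `M` of the perturbations. -/
theorem IsBandlimitedKernel.le_minimaxRisk (h : IsBandlimitedKernel ψ G K)
    {φ : Measure ℝ} [IsProbabilityMeasure φ] {C C' w w' t₁ α A s c L χ y₀ : ℝ} {M n : ℕ}
    (hA : 1 / 2 ≤ φ (Set.Icc (-A) A)) (hE : ErrorCondition φ C C' w w' t₁ 0 α)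
    (hC : 0 ≤ C) (hC' : 0 ≤ C') (hw : 0 ≤ w) (hww' : w ≤ w')
    (hs : 0 < s) (hs1 : s ≤ 1) (hc : 0 < c) (hL : 0 < L) (hσ : c < σ)
    (hσL : 2 * Real.exp (2 * c) / (σ - c) ≤ Real.pi * L)
    (hT : 1 ≤ T) (ht : t₁ < 2 * Real.pi * T) (hb : 0 ≤ b)
    (hP : b * K * (2 + σ ^ 2) ≤ Real.pi⁻¹ * σ)
    (hS : 16 * (b ^ 2 / T) * K ^ 2 * Real.exp (2 * c * (4 * Real.pi * T) ^ s) ≤ L)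
    (hM : 0 < M) (hy₀ : 0 < y₀) (hMT : M * y₀ ≤ T) (hyK : 2 * K ≤ G 0 * (1 + y₀ ^ 2))
    (hχ : 0 ≤ χ) (hχb : 8 * T
        * (b / T * K * (C + 2 * Real.pi * C + 2 * Real.pi * C') * T ^ (-w)) ^ 2
      ≤ σ * (2 * Real.pi * (2 + 2 * A ^ 2 + σ ^ 2))⁻¹ * χ)
    (hχM : (1 + χ) ^ n ≤ (M : ℝ) / 4) :
    ENNReal.ofReal (b * G 0 / 8) ≤ minimaxRisk φ (supersmoothClass c s L) n := by
  have hσ0 : 0 < σ := hc.trans hσ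
  have hT0 : 0 < T := by linarith
  have hpi := Real.pi_pos
  set z : Fin M → ℝ := fun m => (m : ℝ) * y₀ / T with hzdef
  have hz : ∀ m, |z m| ≤ 1 := by
    intro m
    have : (m : ℝ) ≤ M := by exact_mod_cast m.2.le
    rw [hzdef, abs_of_nonneg (by positivity), div_le_one hT0]
    exact (mul_le_mul_of_nonneg_right this hy₀.le).trans hMT
  have hmem : ∀ m, perturbedDensity σ G b T (z m) ∈ supersmoothClass c s L := fun m =>
    h.perturbedDensity_mem hs hs1 hc hL hσ hσL hT hb (hz m) hP hS
  have hcb : ∀ x, |cauchyDensity σ x| ≤ Real.pi⁻¹ * σ * (σ ^ 2)⁻¹ := fun x => by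
    rw [abs_of_pos (cauchyDensity_pos hσ0 x)]
    exact cauchyDensity_le hσ0 x
  have hr := fun m => exists_likelihoodRatio (φ := φ) (continuous_cauchyDensity hσ0)
    (h.continuous_scaledKernel (b := b) (T := T) (z := z m)) hcb (h.abs_scaledKernel_le hb)
    (fun x => (cauchyDensity_pos hσ0 x).le) (integrable_cauchyDensity hσ0)
    (integral_cauchyDensity hσ0) (hmem m).2.1 (h.integrable_scaledKernel hT0)
    (h.integral_scaledKernel hT0) (by positivity) hχ
    (le_measureConv_cauchyDensity hσ0 A φ hA)
    ((h.lintegral_weighted_measureConv_le hE hC hC' hw hww' hT ht hb (hz m)).trans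
      (ENNReal.ofReal_le_ofReal hχb))
  choose r hrm hobs hr2 using hr
  have := isProbabilityMeasure_observationLaw (φ := φ) (integrable_cauchyDensity hσ0)
    (fun x => (cauchyDensity_pos hσ0 x).le) (integral_cauchyDensity hσ0)
  have hG := h.pos_zero
  have key := _root_.le_minimaxRisk φ (supersmoothClass c s L) n hM
    (fun m => perturbedDensity σ G b T (z m)) hmem z (δ := b * G 0 / 2) (by positivity) ?_
    (observationLaw (cauchyDensity σ) φ) r hrm
    (fun m => isProbabilityMeasure_observationLaw (hmem m).2.2.1 (hmem m).2.1 (hmem m).2.2.2.1)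
    hobs (ENNReal.ofReal (1 + χ)) hr2 ?_
  · convert! key using 2
    ring
  · intro m l hml
    have hd : y₀ ≤ |T * (z m - z l)| := by
      have h1 : T * (z m - z l) = ((m : ℝ) - l) * y₀ := by
        simp only [hzdef]
        field_simp
      have h2 : (1 : ℝ) ≤ |(m : ℝ) - l| := by
        have h3 : ((m : ℕ) : ℤ) - ((l : ℕ) : ℤ) ≠ 0 := by
          intro h4
          exact hml (Fin.ext (by omega))
        have h5 := Int.one_le_abs h3
        exact_mod_cast h5
      rw [h1, abs_mul, abs_of_pos hy₀]
      nlinarith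
    -- At rescaled distance at least `y₀` the kernel has fallen to half its central value, which
    -- leaves a separation of `b G(0) / 2`.
    have hGs : G (T * (z m - z l)) ≤ G 0 / 2 := by
      refine (le_abs_self _).trans ((h.decay _).trans ?_)
      rw [← div_eq_mul_inv, div_le_iff₀ (by positivity)]
      have h6 : y₀ ^ 2 ≤ (T * (z m - z l)) ^ 2 := by
        rw [← sq_abs (T * (z m - z l))]
        gcongr
      nlinarith
    simp only [perturbedDensity, scaledKernel, sub_self, mul_zero]
    refine le_trans ?_ (le_abs_self _)
    nlinarith [mul_le_mul_of_nonneg_left hGs hb]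
  · rw [← ENNReal.ofReal_pow (by positivity)]
    refine (ENNReal.ofReal_le_ofReal hχM).trans ?_
    rw [ENNReal.ofReal_div_of_pos (by norm_num), ENNReal.ofReal_natCast]
    simp

end Hypotheses

/-! ### Choice of the parameters and the rate -/

open Filter in
/-- Choice of the bandwidth and of the number of hypotheses for a large logarithmic sample size. -/
theorem eventually_bandwidth_conditions {a s y₀ η : ℝ} (ha : 0 < a) (hs : 0 < s) (hy₀ : 0 < y₀)
    (hη : 0 < η) (β p t₁ : ℝ) :
    ∀ᶠ l : ℝ in atTop, 1 ≤ l ∧ 1 ≤ (a * l) ^ (1 / s) ∧ t₁ < 2 * Real.pi * (a * l) ^ (1 / s) ∧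
      β ^ 2 * Real.log l * l ^ p * Real.exp (-l / 2) ≤ η ∧
      ∃ M : ℕ, 0 < M ∧ M * y₀ ≤ (a * l) ^ (1 / s) ∧ l ^ (1 / (2 * s)) ≤ M / 4 := by
  have hpi := Real.pi_gt_three
  have hT : Tendsto (fun l : ℝ => (a * l) ^ (1 / s)) atTop atTop :=
    (tendsto_rpow_atTop (by positivity)).comp (tendsto_id.const_mul_atTop ha)
  have hX : Tendsto (fun l : ℝ => l ^ (1 / (2 * s))) atTop atTop :=
    tendsto_rpow_atTop (by positivity)
  have hdecay : Tendsto (fun l : ℝ => β ^ 2 * (l ^ (p + 1) * Real.exp (-(1 / 2) * l))) atTop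
      (nhds 0) := by
    simpa using
      (tendsto_rpow_mul_exp_neg_mul_atTop_nhds_zero (p + 1) (1 / 2) (by norm_num)).const_mul (β ^ 2)
  filter_upwards [eventually_ge_atTop 1, hT.eventually_ge_atTop 1, hT.eventually_gt_atTop t₁,
    hX.eventually_ge_atTop 1, hX.eventually_ge_atTop (5 * y₀ / a ^ (1 / s)),
    hdecay.eventually_le_const hη] with l hl h1 h2 h3 h4 h5
  have hl0 : 0 < l := by linarith
  have ha' : 0 < a ^ (1 / s) := by positivity
  refine ⟨hl, h1, h2.trans_le (by nlinarith), ?_, ?_⟩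
  · refine le_trans ?_ h5
    rw [Real.rpow_add_one hl0.ne', mul_assoc, mul_assoc]
    refine mul_le_mul_of_nonneg_left ?_ (sq_nonneg β)
    have h6 : Real.log l ≤ l := (Real.log_le_sub_one_of_pos hl0).trans (by linarith)
    rw [show -l / 2 = -(1 / 2) * l by ring, ← mul_assoc, mul_comm (l ^ p) l]
    gcongr
  · set X := l ^ (1 / (2 * s)) with hXdef
    have h6 : (a * l) ^ (1 / s) = a ^ (1 / s) * X ^ 2 := by
      rw [Real.mul_rpow ha.le hl0.le, hXdef, ← Real.rpow_natCast, ← Real.rpow_mul hl0.le]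
      congr 2
      push_cast
      field_simp
    -- The factor `5` rather than `4` absorbs the loss of one in the floor, as `X ≥ 1`.
    have h7 : 5 * X ≤ (a * l) ^ (1 / s) / y₀ := by
      rw [h6, le_div_iff₀ hy₀]
      rw [div_le_iff₀ ha'] at h4
      nlinarith
    have h8 := Nat.lt_floor_add_one ((a * l) ^ (1 / s) / y₀)
    refine ⟨⌊(a * l) ^ (1 / s) / y₀⌋₊, ?_, ?_, ?_⟩
    · rw [Nat.floor_pos]
      linarith
    · rw [← le_div_iff₀ hy₀]
      exact Nat.floor_le (by positivity)
    · linarith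

/-- The rate of convergence. -/
noncomputable def deconvolutionRate (w s : ℝ) (n : ℕ) : ℝ :=
  (Real.log (Real.log n) / n) ^ (1 / 2 : ℝ) * (Real.log n) ^ ((w + 1 / 2) / s)

theorem deconvolutionRate_pos (w s : ℝ) {n : ℕ} (hn : 3 ≤ n) : 0 < deconvolutionRate w s n := by
  have hn' : (3 : ℝ) ≤ n := by exact_mod_cast hn
  have h1 : 1 < Real.log n := by
    rw [Real.lt_log_iff_exp_lt (by linarith)]
    linarith [Real.exp_one_lt_d9]
  have h2 := Real.log_pos h1
  unfold deconvolutionRate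
  positivity

theorem deconvolutionRate_sq (w s : ℝ) {n : ℕ} (hn : 3 ≤ n) :
    deconvolutionRate w s n ^ 2
      = Real.log (Real.log n) / n * (Real.log n) ^ ((2 * w + 1) / s) := by
  have hn' : (3 : ℝ) ≤ n := by exact_mod_cast hn
  have h1 : 1 < Real.log n := by
    rw [Real.lt_log_iff_exp_lt (by linarith)]
    linarith [Real.exp_one_lt_d9]
  have h2 := Real.log_pos h1
  rw [deconvolutionRate, mul_pow, ← Real.rpow_natCast, ← Real.rpow_natCast,
    ← Real.rpow_mul (by positivity), ← Real.rpow_mul (by positivity)]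
  congr 1
  · norm_num
  · congr 1
    push_cast
    ring

/-- The lower bound for large samples, stated so that it also bounds the risk of smaller samples. -/
theorem exists_le_minimaxRisk_of_le (s ctilde L C C' w w' t₁ A : ℝ)
    (hs : 0 < s) (hs1 : s ≤ 1) (hctilde : 0 < ctilde) (hL : 0 < L)
    (hC : 0 < C) (hC' : 0 < C') (hw : 0 ≤ w) (hww' : w ≤ w') :
    ∃ c₀ : ℝ, 0 < c₀ ∧ ∃ N₀ : ℕ, 3 ≤ N₀ ∧ ∀ (φ : Measure ℝ) (_ : IsProbabilityMeasure φ) (α : ℝ),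
      1 / 2 ≤ φ (Set.Icc (-A) A) → ErrorCondition φ C C' w w' t₁ 0 α →
      ∀ N n : ℕ, N₀ ≤ N → n ≤ N → ENNReal.ofReal (c₀ * deconvolutionRate w s N)
        ≤ minimaxRisk φ (supersmoothClass ctilde s L) n := by
  have hpi := Real.pi_pos
  obtain ⟨ψ, G, K, k1, k2, k3, k4, k5, k6, k7, k8, k9, k10, k11⟩ := exists_bandlimited_kernel
  have h : IsBandlimitedKernel ψ G K := ⟨k1, k2, k3, k4, k5, k6, k7, k8, k9, k10, k11⟩
  have hK := h.pos
  have hG := h.pos_zero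
  obtain ⟨σ, hσ, hσL⟩ : ∃ σ, ctilde < σ ∧
      2 * Real.exp (2 * ctilde) / (σ - ctilde) ≤ Real.pi * L := by
    refine ⟨ctilde + 2 * Real.exp (2 * ctilde) / (Real.pi * L),
      lt_add_of_pos_right _ (by positivity), ?_⟩
    rw [add_sub_cancel_left, div_div_cancel₀ (by positivity)]
  have hσ0 : 0 < σ := hctilde.trans hσ
  set κ := σ * (2 * Real.pi * (2 + 2 * A ^ 2 + σ ^ 2))⁻¹ with hκdef
  have hκ : 0 < κ := by positivity
  set K₁ := C + 2 * Real.pi * C + 2 * Real.pi * C' with hK₁def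
  have hK₁ : 0 < K₁ := by positivity
  set p := (2 * w + 1) / s with hp
  -- Chosen so that `2c(4πT)^s = l/2`; the class weight is then `√N`.
  set a := (4 * ctilde * (4 * Real.pi) ^ s)⁻¹ with hadef
  have ha : 0 < a := by positivity
  -- Chosen so that the weighted `L²` bound equals `κχ` exactly, with `χ = log l / (2sN)`.
  set β := Real.sqrt (κ * (1 / (2 * s)) * a ^ p / (8 * K ^ 2 * K₁ ^ 2)) with hβdef
  have hβ : 0 < β := Real.sqrt_pos.2 (by positivity)
  have hβ2 : β ^ 2 = κ * (1 / (2 * s)) * a ^ p / (8 * K ^ 2 * K₁ ^ 2) :=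
    Real.sq_sqrt (by positivity)
  set y₀ := Real.sqrt (2 * K / G 0) with hy₀def
  have hy₀ : 0 < y₀ := Real.sqrt_pos.2 (by positivity)
  have hyK : 2 * K ≤ G 0 * (1 + y₀ ^ 2) := by
    rw [hy₀def, Real.sq_sqrt (by positivity), mul_add, mul_div_cancel₀ _ hG.ne']
    linarith
  set B := Real.pi⁻¹ * σ / (K * (2 + σ ^ 2)) with hBdef
  have hB : 0 < B := by positivity
  -- The two entries guarantee membership in the class and nonnegativity, respectively.
  set η := min (L / (16 * K ^ 2)) (B ^ 2) with hηdef
  have hη : 0 < η := lt_min (by positivity) (by positivity)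
  obtain ⟨l₀, hl₀⟩ := Filter.eventually_atTop.1
    (eventually_bandwidth_conditions ha hs hy₀ hη β p t₁)
  refine ⟨β * G 0 / 8, by positivity, max 3 ⌈Real.exp l₀⌉₊, le_max_left _ _, ?_⟩
  intro φ _ α hA hE N n hN hn
  have hN3 : 3 ≤ N := (le_max_left _ _).trans hN
  have hN0 : (0 : ℝ) < N := by
    have : 0 < N := by omega
    exact_mod_cast this
  have hNl : Real.exp l₀ ≤ N := by
    have := (le_max_right _ _).trans hN
    exact (Nat.le_ceil _).trans (by exact_mod_cast this)
  obtain ⟨e1, e2, e3, e4, M, e5, e6, e7⟩ := hl₀ (Real.log N) ((Real.le_log_iff_exp_le hN0).2 hNl)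
  set l := Real.log N with hl
  have hl0 : 0 < l := by linarith
  have hNe : Real.exp l = N := Real.exp_log hN0
  have hlog : 0 ≤ Real.log l := Real.log_nonneg e1
  set T := (a * l) ^ (1 / s) with hTdef
  have hT0 : 0 < T := by linarith
  set b := β * deconvolutionRate w s N with hbdef
  have hb : 0 < b := mul_pos hβ (deconvolutionRate_pos w s hN3)
  have hb2 : b ^ 2 = β ^ 2 * (Real.log l / N * l ^ p) := by
    rw [hbdef, mul_pow, deconvolutionRate_sq w s hN3]
  have hbexp : b ^ 2 * Real.exp (l / 2) ≤ η := by
    refine le_trans (le_of_eq ?_) e4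
    rw [hb2, ← hNe, show -l / 2 = l / 2 - l by ring, Real.exp_sub]
    ring
  have hb2η : b ^ 2 ≤ η := by
    refine le_trans ?_ hbexp
    exact le_mul_of_one_le_right (sq_nonneg b) (Real.one_le_exp (by positivity))
  have hTs : (4 * Real.pi * T) ^ s = (4 * Real.pi) ^ s * (a * l) := by
    rw [Real.mul_rpow (by positivity) hT0.le, hTdef, ← Real.rpow_mul (by positivity),
      one_div, inv_mul_cancel₀ hs.ne', Real.rpow_one]
  have hTw : T ^ (2 * w + 1) = a ^ p * l ^ p := by
    rw [hTdef, ← Real.rpow_mul (by positivity), ← Real.mul_rpow ha.le hl0.le, hp]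
    congr 1
    ring
  have key := h.le_minimaxRisk (b := b) (T := T) (M := M) (n := n)
    (χ := 1 / (2 * s) * Real.log l / N) hA hE hC.le hC'.le hw hww' hs hs1 hctilde hL hσ hσL
    e2 e3 hb.le ?_ ?_ e5 hy₀ e6 hyK (by positivity) ?_ ?_
  · convert! key using 2
    rw [hbdef]
    ring
  · have h1 : b ≤ B := (pow_le_pow_iff_left₀ hb.le hB.le two_ne_zero).1
      (hb2η.trans (min_le_right _ _))
    rw [hBdef, le_div_iff₀ (by positivity)] at h1
    linarith
  · have h1 : 2 * ctilde * (4 * Real.pi * T) ^ s = l / 2 := by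
      rw [hTs, hadef]
      field_simp
      ring
    have h2 : b ^ 2 / T ≤ b ^ 2 := div_le_self (sq_nonneg b) e2
    have h3 := hbexp.trans (min_le_left _ _)
    rw [le_div_iff₀ (by positivity)] at h3
    rw [h1]
    calc 16 * (b ^ 2 / T) * K ^ 2 * Real.exp (l / 2)
        ≤ 16 * b ^ 2 * K ^ 2 * Real.exp (l / 2) := by gcongr
      _ = b ^ 2 * Real.exp (l / 2) * (16 * K ^ 2) := by ring
      _ ≤ L := h3
  · have h1 : 8 * T * (b / T * K * K₁ * T ^ (-w)) ^ 2
        = 8 * b ^ 2 * K ^ 2 * K₁ ^ 2 * (T ^ (2 * w + 1))⁻¹ := by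
      have h2 : T ^ (2 * w + 1) = (T ^ w) ^ 2 * T := by
        rw [Real.rpow_add_one hT0.ne', ← Real.rpow_natCast (T ^ w), ← Real.rpow_mul hT0.le]
        congr 2
        push_cast
        ring
      have h3 : T ^ w ≠ 0 := by positivity
      rw [h2, Real.rpow_neg hT0.le]
      field_simp
    rw [h1, hTw, hb2, hβ2, ← hκdef]
    have h4 : a ^ p ≠ 0 := by positivity
    have h5 : l ^ p ≠ 0 := by positivity
    refine le_of_eq ?_
    field_simp
  -- The perturbation is tuned to `N`; fewer observations only lower the second moment. The exponent
  -- `1/(2s)` is half that of `M`, which leaves room for the constants.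
  · have hnN : (n : ℝ) ≤ N := by exact_mod_cast hn
    set χ := 1 / (2 * s) * Real.log l / N with hχdef
    have hχ : 0 ≤ χ := by positivity
    calc (1 + χ) ^ n ≤ Real.exp χ ^ n := by
          gcongr
          linarith [Real.add_one_le_exp χ]
      _ = Real.exp (n * χ) := (Real.exp_nat_mul χ n).symm
      _ ≤ Real.exp (N * χ) := by gcongr
      _ = l ^ (1 / (2 * s)) := by
          rw [Real.rpow_def_of_pos hl0, hχdef, mul_div_cancel₀ _ hN0.ne', mul_comm]
      _ ≤ M / 4 := e7

/-! ### From large samples to all sample sizes -/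

theorem theorem5 (s ctilde L C C' w w' t₁ A : ℝ)
    (hs : 0 < s) (hs1 : s ≤ 1) (hctilde : 0 < ctilde) (hL : 0 < L)
    (hC : 0 < C) (hC' : 0 < C') (hw : 0 ≤ w) (hww' : w ≤ w') (ht₁ : 0 ≤ t₁) :
    ∃ c : ℝ, 0 < c ∧
      ∀ (φ : Measure ℝ) (_ : IsProbabilityMeasure φ) (α : ℝ),
        1 / 2 ≤ φ (Set.Icc (-A) A) →
        ErrorCondition φ C C' w w' t₁ 0 α →
        ∀ n : ℕ, 3 ≤ n →
          ENNReal.ofReal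
              (c * (Real.log (Real.log n) / n) ^ (1 / 2 : ℝ) * (Real.log n) ^ ((w + 1 / 2) / s))
            ≤ minimaxRisk φ (supersmoothClass ctilde s L) n := by
  obtain ⟨c₀, hc₀, N₀, hN₀, hmain⟩ :=
    exists_le_minimaxRisk_of_le s ctilde L C C' w w' t₁ A hs hs1 hctilde hL hC hC' hw hww'
  -- `R` dominates all rates up to `N₀`. For `n ≤ N₀` the hypotheses tuned to `N₀` are reused, and
  -- the factor `deconvolutionRate w s N₀ / R` makes the constant fit. Absolute values neutralise
  -- the meaningless rates for `n < 3`.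
  set R := ∑ n ∈ Finset.range (N₀ + 1), |deconvolutionRate w s n| with hR
  have hRle : ∀ n ≤ N₀, deconvolutionRate w s n ≤ R := fun n hn =>
    (le_abs_self _).trans (Finset.single_le_sum (f := fun n => |deconvolutionRate w s n|)
      (fun i _ => abs_nonneg _) (Finset.mem_range.2 (Nat.lt_succ_of_le hn)))
  have hr₀ := deconvolutionRate_pos w s hN₀
  have hR0 : 0 < R := hr₀.trans_le (hRle N₀ le_rfl)
  refine ⟨c₀ * (deconvolutionRate w s N₀ / R), by positivity, fun φ hφ α hA hE n hn => ?_⟩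
  have hr := deconvolutionRate_pos w s hn
  rw [mul_assoc]
  change ENNReal.ofReal (c₀ * (deconvolutionRate w s N₀ / R) * deconvolutionRate w s n) ≤ _
  rcases le_total N₀ n with h | h
  · refine (ENNReal.ofReal_le_ofReal ?_).trans (hmain φ hφ α hA hE n n h le_rfl)
    have h1 : deconvolutionRate w s N₀ / R ≤ 1 := (div_le_one hR0).2 (hRle N₀ le_rfl)
    have h2 : c₀ * (deconvolutionRate w s N₀ / R) ≤ c₀ := mul_le_of_le_one_right hc₀.le h1
    gcongr
  · refine (ENNReal.ofReal_le_ofReal ?_).trans (hmain φ hφ α hA hE N₀ n le_rfl h)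
    have h1 : deconvolutionRate w s n / R ≤ 1 := (div_le_one hR0).2 (hRle n h)
    calc c₀ * (deconvolutionRate w s N₀ / R) * deconvolutionRate w s n
        = c₀ * deconvolutionRate w s N₀ * (deconvolutionRate w s n / R) := by ring
      _ ≤ _ := mul_le_of_le_one_right (by positivity) h1
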